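/- Let $\Omega=\{0,1\}^{\mathbb N}$ be Cantor space, $\Gamma_x\subseteq\Omega$ the set of infinite sequences extending the finite binary sequence $x$, and let $P$ be a computable Borel probability measure on $\Omega$, i.e. $x\mapsto P(\Gamma_x)$ is the limit both of a computable non-decreasing and of a computable non-increasing sequence of rational-valued functions of $x$. Let $f:\Omega\to[0,\infty)$ be a $P$-integrable function that is computable, i.e. $f$ is the everywhere pointwise limit both of a computable non-decreasing and of a computable non-increasing sequence of simple functions (functions taking constant rational values on the members of a finite cover of $\Omega$ by intervals $\Gamma_x$). Let $T:\Omega\to\Omega$ be a $P$-preserving transformation that is computable, i.e. there is a recursively enumerable set $\hat T$ of pairs of finite binary sequences such that (i) if $(x,y),(x',y')\in\hat T$ and $x$ is a prefix of $x'$, then one of $y,y'$ is a prefix of the other; (ii) if $(x,y)\in\hat T$ and $y'$ is a prefix of $y$, then $(x,y')\in\hat T$; (iii) $(x,\lambda)\in\hat T$ for every $x$, where $\lambda$ is the empty sequence; (iv) for every $\omega\in\Omega$, $T\omega$ is the supremum, in the prefix order, of all $y$ with $(x,y)\in\hat T$ for some prefix $x$ of $\omega$. A point $\omega\in\Omega$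 is Martin-Löf $P$-random if $\omega\notin\bigcap_n U_n$ for every sequence $(U_n)$ of uniformly effectively open sets (unions of intervals $\Gamma_x$ enumerated by one algorithm uniformly in $n$) with $P(U_n)\le 2^{-n}$ for all $n$. Then there is a $P$-integrable function $\tilde f:\Omega\to\mathbb R$, invariant under $T$ (that is, $\tilde f(T\omega)=\tilde f(\omega)$ for all $\omega$), with $\int\tilde f\,dP=\int f\,dP$, such that $$\lim_{n\to\infty}\frac1n\sum_{k=0}^{n-1}f(T^k\omega)=\tilde f(\omega)$$ for every Martin-Löf $P$-random $\omega$. Moreover, if $T$ is ergodic with respect to $P$, then $\tilde f(\omega)=\int f\,dP$ for every Martin-Löf $P$-random $\omega$. -/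

import Mathlib

namespace AlgorithmicErgodic

/-! ### Cantor space and rational codes -/

/-- The Cantor space `Ω` of infinite binary sequences, with Mathlib's product topology and
product (= Borel) σ-algebra. -/
abbrev Cantor : Type := ℕ → Bool

/-- The finite sequence `x` is an initial segment of the infinite sequence `ω`. -/
def IsPrefix (x : List Bool) (ω : Cantor) : Prop :=
  ∀ (i : ℕ) (hi : i < x.length), x[i] = ω i

instance (x : List Bool) (ω : Cantor) : Decidable (IsPrefix x ω) :=
  inferInstanceAs (Decidable (∀ (i : ℕ) (hi : i < x.length), x[i] = ω i))

/-- The interval `Γ_x` of all infinite sequences that extend `x`. -/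
def cylinder (x : List Bool) : Set Cantor := {ω | IsPrefix x ω}

/-- Rational numbers as finite objects: the triple `((a, b), c)` names `(a - b) / (c + 1)`. -/
abbrev RatCode : Type := (ℕ × ℕ) × ℕ

/-- The rational number with a given name; every rational number has a name. -/
def RatCode.val (r : RatCode) : ℚ := ((r.1.1 : ℚ) - (r.1.2 : ℚ)) / ((r.2 : ℚ) + 1)

/-! ### Computable real functions of a finite object, computable measures -/

/-- A real function of a finite object is lower semicomputable if it is the limit of a computable
non-decreasing sequence of rational functions. -/
def LowerSemicomputable {A : Type} [Primcodable A] (g : A → ℝ) : Prop :=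
  ∃ h : ℕ → A → RatCode, Computable₂ h ∧
    (∀ n x, (h n x).val ≤ (h (n + 1) x).val) ∧
    ∀ x, Filter.Tendsto (fun n => (((h n x).val : ℚ) : ℝ)) Filter.atTop (nhds (g x))

/-- A real function of a finite object is upper semicomputable if it is the limit of a computable
non-increasing sequence of rational functions. -/
def UpperSemicomputable {A : Type} [Primcodable A] (g : A → ℝ) : Prop :=
  ∃ h : ℕ → A → RatCode, Computable₂ h ∧
    (∀ n x, (h (n + 1) x).val ≤ (h n x).val) ∧
    ∀ x, Filter.Tendsto (fun n => (((h n x).val : ℚ) : ℝ)) Filter.atTop (nhds (g x))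

/-- A measure on Cantor space is computable if `x ↦ P(Γ_x)` is lower and upper semicomputable. -/
def ComputableMeasure (P : MeasureTheory.Measure Cantor) : Prop :=
  LowerSemicomputable (fun x : List Bool => P.real (cylinder x)) ∧
    UpperSemicomputable (fun x : List Bool => P.real (cylinder x))

/-! ### Martin-Löf randomness -/

/-- A sequence of sets is uniformly effectively open if `U n` is the union of the intervals
`Γ_{x_{n,i}}`, `i = 0, 1, …`, where `(n, i) ↦ x_{n,i}` is partial recursive (an undefined
`x_{n,i}` contributes nothing, so that `U n` may be empty). -/
def UniformlyEffectivelyOpen (U : ℕ → Set Cantor) : Prop :=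
  ∃ e : ℕ → ℕ →. List Bool, Partrec₂ e ∧
    ∀ n, U n = {ω | ∃ i, ∃ x ∈ e n i, ω ∈ cylinder x}

/-- A Martin-Löf test with respect to `P`. -/
def IsMartinLofTest (P : MeasureTheory.Measure Cantor) (U : ℕ → Set Cantor) : Prop :=
  UniformlyEffectivelyOpen U ∧ ∀ n, P (U n) ≤ (2⁻¹ : ENNReal) ^ n

/-- `ω` is Martin-Löf random with respect to `P` if it passes every Martin-Löf test. -/
def IsMartinLofRandom (P : MeasureTheory.Measure Cantor) (ω : Cantor) : Prop :=
  ∀ U : ℕ → Set Cantor, IsMartinLofTest P U → ω ∉ ⋂ n, U n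

/-! ### Computable functions on Cantor space -/

/-- Simple functions as finite objects: a list of pairs (interval, rational value). -/
abbrev SimpleCode : Type := List (List Bool × RatCode)

/-- The simple function with a given code: its value at `ω` is the one attached to the first
listed interval that contains `ω`, and `0` if there is none. The functions so obtained are exactly
those which take constant rational values on the members of a finite cover by intervals. -/
def SimpleCode.eval : SimpleCode → Cantor → ℚ
  | [], _ => 0
  | (x, r) :: l, ω => if IsPrefix x ω then r.val else SimpleCode.eval l ω

/-- `f : Ω → ℝ` is lower semicomputable if it is the pointwise limit of a computable
non-decreasing sequence of simple functions. -/
def LowerSemicomputableFun (f : Cantor → ℝ) : Prop :=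
  ∃ h : ℕ → SimpleCode, Computable h ∧
    (∀ n ω, SimpleCode.eval (h n) ω ≤ SimpleCode.eval (h (n + 1)) ω) ∧
    ∀ ω, Filter.Tendsto (fun n => ((SimpleCode.eval (h n) ω : ℚ) : ℝ)) Filter.atTop (nhds (f ω))

/-- `f : Ω → ℝ` is upper semicomputable if it is the pointwise limit of a computable
non-increasing sequence of simple functions. -/
def UpperSemicomputableFun (f : Cantor → ℝ) : Prop :=
  ∃ h : ℕ → SimpleCode, Computable h ∧
    (∀ n ω, SimpleCode.eval (h (n + 1)) ω ≤ SimpleCode.eval (h n) ω) ∧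
    ∀ ω, Filter.Tendsto (fun n => ((SimpleCode.eval (h n) ω : ℚ) : ℝ)) Filter.atTop (nhds (f ω))

/-- `f : Ω → ℝ` is computable if it is lower and upper semicomputable. -/
def ComputableFun (f : Cantor → ℝ) : Prop :=
  LowerSemicomputableFun f ∧ UpperSemicomputableFun f

/-! ### Computable transformations -/

/-- A computable representation of a transformation: a recursively enumerable set of pairs of
finite sequences with the usual compatibility conditions; `<+:` is the prefix order on lists. -/
structure IsComputableRepresentation (R : Set (List Bool × List Bool)) : Prop where
  re : REPred fun p : List Bool × List Bool => p ∈ R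
  compatible : ∀ x y x' y', (x, y) ∈ R → (x', y') ∈ R → x <+: x' → y <+: y' ∨ y' <+: y
  closed : ∀ x y y', (x, y) ∈ R → y' <+: y → (x, y') ∈ R
  nil_mem : ∀ x, (x, []) ∈ R

/-- `T : Ω → Ω` is computable if for some computable representation `R` and every `ω` the infinite
sequence `T ω` is the supremum, in the prefix order, of `{y | ∃ x ⊆ ω, (x, y) ∈ R}`: every such
`y` is a prefix of `T ω`, and such `y` have arbitrarily large length. -/
def ComputableTransformation (T : Cantor → Cantor) : Prop :=
  ∃ R : Set (List Bool × List Bool), IsComputableRepresentation R ∧ ∀ ω : Cantor,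
    (∀ x y, IsPrefix x ω → (x, y) ∈ R → IsPrefix y (T ω)) ∧
    ∀ n : ℕ, ∃ x y, IsPrefix x ω ∧ (x, y) ∈ R ∧ n ≤ y.length

end AlgorithmicErgodic

/-!
Bishop's upcrossing inequality bounds by `∫ max (f - α) 0 / (N (β - α))` the measure of the points
whose Birkhoff averages cross from below `α` to above `β` at least `N` times. For computable `f`,
`T` and rational `α < β` the set of these points is effectively open, uniformly in `N`; hence along
a computable sequence of `N` it forms a Martin-Löf test, and the averages oscillate at no random
point.

If `T` is ergodic and `r > ∫ f`, the averages are eventually below `r` almost everywhere, so the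
measure of the effectively open set of points whose `n`-th average is below `r` tends to `1`. As the
measures of effectively open sets can be approximated from below, one can compute a subsequence of
times at which these measures exceed `1 - 2⁻ᵏ`. At these times the effectively open sets of points
whose average is above `r` have measure at most `2⁻ᵏ`, and by effective Borel–Cantelli a random
point lies in only finitely many of them. So the limit at a random point is at most `∫ f`, and the
same argument for `-f` gives equality.
-/

namespace AlgorithmicErgodic

open Encodable Filter Function MeasureTheory Set Topology

section RecursivelyEnumerable

/-- `b` is reached from `a` in `n` steps of the relation `R`. -/
def StepsTo {A : Type*} (R : Set (A × A)) : ℕ → A → A → Prop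
  | 0, a, b => a = b
  | n + 1, a, b => ∃ c, (a, c) ∈ R ∧ StepsTo R n c b

theorem stepsTo_iff_exists_list {A : Type*} [Inhabited A] {R : Set (A × A)} {n : ℕ} {a b : A} :
    StepsTo R n a b ↔ ∃ l : List A, l.getD 0 default = a ∧ l.getD n default = b ∧
      ∀ i < n, (l.getD i default, l.getD (i + 1) default) ∈ R := by
  induction n generalizing a with
  | zero =>
    refine ⟨fun h => ⟨[a], rfl, h, by simp⟩, ?_⟩
    rintro ⟨l, rfl, rfl, -⟩
    rfl
  | succ n ih =>
    constructor
    · rintro ⟨c, hac, hcb⟩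
      obtain ⟨l, rfl, hlb, hl⟩ := ih.1 hcb
      refine ⟨a :: l, rfl, hlb, fun i hi => ?_⟩
      cases i with
      | zero => exact hac
      | succ i => exact hl i (by lia)
    · rintro ⟨l, rfl, hlb, hl⟩
      refine ⟨_, hl 0 n.succ_pos, ih.2 ⟨l.tail, ?_⟩⟩
      have htail : ∀ i, l.tail.getD i default = l.getD (i + 1) default := by
        cases l <;> simp
      simpa only [htail, hlb, true_and] using fun i hi => hl (i + 1) (by lia)

variable {A B : Type*} [Primcodable A] [Primcodable B] {p q : A → Prop}

theorem rePred_iff_exists_primrecRel :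
    REPred p ↔ ∃ s : A → ℕ → Prop, PrimrecRel s ∧ ∀ a, p a ↔ ∃ n, s a n := by
  constructor
  · intro hp
    obtain ⟨c, hc⟩ := Nat.Partrec.Code.exists_code.1 hp
    refine ⟨fun a k => (c.evaln k (encode a)).isSome, ?_, fun a => ?_⟩
    · have hevaln : Primrec fun x : A × ℕ => (c.evaln x.2 (encode x.1)).isSome :=
        Primrec.option_isSome.comp (Nat.Partrec.Code.primrec_evaln.comp
          ((Primrec.snd.pair (.const c)).pair (Primrec.encode.comp .fst)))
      exact Primrec.eq.comp hevaln (.const true)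
    · have halts : p a ↔ (c.eval (encode a)).Dom := by simp [hc, Part.assert]
      simp only [halts, Part.dom_iff_mem, Nat.Partrec.Code.evaln_complete,
        Option.isSome_iff_exists, Option.mem_def]
      exact exists_comm
  · rintro ⟨s, hs, hps⟩
    classical
    have search : Partrec fun a => Nat.rfind fun n => Part.some (decide (s a n)) :=
      Partrec.rfind (primrecRel_iff_primrec_decide.1 hs).to_comp.partrec₂
    refine search.dom_re.of_eq fun a => ?_
    rw [hps]
    exact Nat.rfind_dom'.trans (by simp)

theorem rePred_of_primrecPred (hp : PrimrecPred p) : REPred p :=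
  hp.computablePred.to_re

theorem rePred_comp {p : B → Prop} (hp : REPred p) {g : A → B} (hg : Computable g) :
    REPred fun a => p (g a) :=
  Partrec.comp hp hg

theorem rePred_and (hp : REPred p) (hq : REPred q) : REPred fun a => p a ∧ q a := by
  obtain ⟨s, hs, hps⟩ := rePred_iff_exists_primrecRel.1 hp
  obtain ⟨t, ht, hqt⟩ := rePred_iff_exists_primrecRel.1 hq
  refine rePred_iff_exists_primrecRel.2
    ⟨fun a n => s a n.unpair.1 ∧ t a n.unpair.2, ?_, fun a => ?_⟩
  · have hunpair := Primrec.unpair.comp (Primrec.snd (α := A) (β := ℕ))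
    exact PrimrecPred.and (hs.comp .fst (Primrec.fst.comp hunpair))
      (ht.comp .fst (Primrec.snd.comp hunpair))
  · rw [hps, hqt]
    constructor
    · rintro ⟨⟨n, hn⟩, m, hm⟩
      exact ⟨Nat.pair n m, by simpa using ⟨hn, hm⟩⟩
    · rintro ⟨n, hn⟩
      exact ⟨⟨_, hn.1⟩, _, hn.2⟩

theorem rePred_exists {p : A × B → Prop} (hp : REPred p) : REPred fun a => ∃ b, p (a, b) := by
  obtain ⟨s, hs, hps⟩ := rePred_iff_exists_primrecRel.1 hp
  refine rePred_iff_exists_primrecRel.2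
    ⟨fun a n => ∃ b ∈ (decode (α := B) n.unpair.1).toList, s (a, b) n.unpair.2, ?_, fun a => ?_⟩
  · have hmem : PrimrecRel fun (l : List B) (y : A × ℕ) => ∃ b ∈ l, s (y.1, b) y.2.unpair.2 := by
      refine PrimrecRel.exists_mem_list (R := fun b (y : A × ℕ) => s (y.1, b) y.2.unpair.2) ?_
      exact hs.comp ((Primrec.fst.comp .snd).pair .fst)
        (Primrec.snd.comp (Primrec.unpair.comp (Primrec.snd.comp .snd)))
    exact hmem.comp (f := fun x : A × ℕ => (decode (α := B) x.2.unpair.1).toList) (g := fun x => x)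
      (Primrec.optionToList.comp (Primrec.decode.comp
        (Primrec.fst.comp (Primrec.unpair.comp .snd)))) .id
  · constructor
    · rintro ⟨b, hb⟩
      obtain ⟨n, hn⟩ := (hps _).1 hb
      exact ⟨Nat.pair (encode b) n, b, by simp, by simpa using hn⟩
    · rintro ⟨n, b, -, hn⟩
      exact ⟨b, (hps _).2 ⟨_, hn⟩⟩

theorem rePred_forall_mem_list {p : A × B → Prop} (hp : REPred p) :
    REPred fun x : A × List B => ∀ b ∈ x.2, p (x.1, b) := by
  obtain ⟨s, hs, hps⟩ := rePred_iff_exists_primrecRel.1 hp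
  refine rePred_iff_exists_primrecRel.2
    ⟨fun x m => ∀ b ∈ x.2, ∃ t < m, s (x.1, b) t, ?_, fun x => ?_⟩
  · have hbounded : PrimrecRel fun (m : ℕ) (y : A × B) => ∃ t < m, s y t :=
      ((PrimrecRel.exists_mem_list (R := fun t (y : A × B) => s y t) hs.swap).comp
        (Primrec.list_range.comp .fst) .snd).of_eq fun x => by simp
    have hforall : PrimrecRel fun (l : List B) (y : A × ℕ) => ∀ b ∈ l, ∃ t < y.2, s (y.1, b) t :=
      PrimrecRel.forall_mem_list (R := fun b (y : A × ℕ) => ∃ t < y.2, s (y.1, b) t)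
        (hbounded.comp (Primrec.snd.comp .snd) ((Primrec.fst.comp .snd).pair .fst))
    exact hforall.comp (f := fun z : (A × List B) × ℕ => z.1.2) (g := fun z => (z.1.1, z.2))
      (Primrec.snd.comp .fst) ((Primrec.fst.comp .fst).pair .snd)
  · simp only [hps]
    constructor
    · intro h
      classical
      choose! t ht using h
      exact ⟨x.2.toFinset.sup t + 1, fun b hb =>
        ⟨t b, Nat.lt_succ_of_le (Finset.le_sup (List.mem_toFinset.2 hb)), ht b hb⟩⟩
    · rintro ⟨m, h⟩ b hb
      obtain ⟨t, -, ht⟩ := h b hb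
      exact ⟨t, ht⟩

theorem rePred_forall_lt {p : A × ℕ → Prop} (hp : REPred p) :
    REPred fun x : A × ℕ => ∀ i < x.2, p (x.1, i) :=
  (rePred_comp (rePred_forall_mem_list hp) (g := fun x : A × ℕ => (x.1, List.range x.2))
    (Primrec.fst.pair (Primrec.list_range.comp .snd)).to_comp).of_eq fun x => by simp

theorem exists_computable_choice_of_rePred {p : A × ℕ → Prop} (hp : REPred p)
    (hex : ∀ a, ∃ n, p (a, n)) : ∃ g : A → ℕ, Computable g ∧ ∀ a, p (a, g a) := by
  obtain ⟨s, hs, hps⟩ := rePred_iff_exists_primrecRel.1 hp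
  classical
  have hfound : ∀ a, ∃ m : ℕ, s (a, m.unpair.1) m.unpair.2 := by
    intro a
    obtain ⟨n, hn⟩ := hex a
    obtain ⟨t, ht⟩ := (hps _).1 hn
    exact ⟨Nat.pair n t, by simpa using ht⟩
  have hunpair := Primrec.unpair.comp (Primrec.snd (α := A) (β := ℕ))
  have htest : PrimrecPred fun x : A × ℕ => s (x.1, x.2.unpair.1) x.2.unpair.2 :=
    hs.comp (Primrec.fst.pair (Primrec.fst.comp hunpair)) (Primrec.snd.comp hunpair)
  have hfind : Computable fun a => Nat.find (hfound a) :=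
    Computable.find (P := fun a m => s (a, m.unpair.1) m.unpair.2) htest.computablePred hfound
  exact ⟨fun a => (Nat.find (hfound a)).unpair.1,
    Computable.fst.comp (Primrec.unpair.to_comp.comp hfind),
    fun a => (hps _).2 ⟨_, Nat.find_spec (hfound a)⟩⟩

theorem rePred_stepsTo [Inhabited A] {R : Set (A × A)} (hR : REPred (· ∈ R)) :
    REPred fun x : ℕ × (A × A) => StepsTo R x.1 x.2.1 x.2.2 := by
  have hget : Primrec₂ fun (l : List A) i => l.getD i default := Primrec.list_getD default
  have hstep : REPred fun y : List A × ℕ =>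
      (y.1.getD y.2 default, y.1.getD (y.2 + 1) default) ∈ R :=
    rePred_comp hR (Primrec.pair hget (hget.comp .fst (Primrec.succ.comp .snd))).to_comp
  have hchain : REPred fun z : (ℕ × (A × A)) × List A =>
      (z.2.getD 0 default = z.1.2.1 ∧ z.2.getD z.1.1 default = z.1.2.2) ∧
        ∀ i < z.1.1, (z.2.getD i default, z.2.getD (i + 1) default) ∈ R := by
    refine rePred_and (rePred_of_primrecPred (PrimrecPred.and ?_ ?_)) ?_
    · exact Primrec.eq.comp (hget.comp .snd (.const 0)) (Primrec.fst.comp (Primrec.snd.comp .fst))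
    · exact Primrec.eq.comp (hget.comp .snd (Primrec.fst.comp .fst))
        (Primrec.snd.comp (Primrec.snd.comp .fst))
    · exact rePred_comp (rePred_forall_lt hstep)
        (g := fun z : (ℕ × (A × A)) × List A => (z.2, z.1.1))
        (Primrec.snd.pair (Primrec.fst.comp .fst)).to_comp
  exact (rePred_exists hchain).of_eq fun x => by simp only [stepsTo_iff_exists_list, and_assoc]

theorem primrec_two_pow : Primrec fun k : ℕ => 2 ^ k := by
  refine (Primrec.nat_rec₁ 1 (f := fun _ r => r * 2)
    (Primrec.nat_mul.comp .snd (.const 2))).of_eq fun k => ?_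
  induction k with
  | zero => rfl
  | succ k ih => rw [pow_succ, ← ih]

end RecursivelyEnumerable

section RationalCodes

namespace RatCode

theorem exists_val_eq (q : ℚ) : ∃ r : RatCode, r.val = q := by
  refine ⟨((q.num.toNat, (-q.num).toNat), q.den - 1), ?_⟩
  have hnum : (q.num.toNat : ℚ) - ((-q.num).toNat : ℚ) = q.num := by
    exact_mod_cast Int.toNat_sub_toNat_neg q.num
  have hden : ((q.den - 1 : ℕ) : ℚ) + 1 = q.den := by
    exact_mod_cast Nat.sub_add_cancel q.den_pos
  rw [val, hnum, hden, Rat.num_div_den]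

theorem exists_between_val {a b : ℝ} (h : a < b) : ∃ r : RatCode, a < r.val ∧ r.val < b := by
  obtain ⟨q, haq, hqb⟩ := exists_rat_btwn h
  obtain ⟨r, rfl⟩ := exists_val_eq q
  exact ⟨r, haq, hqb⟩

theorem val_lt_val_iff (r s : RatCode) :
    r.val < s.val ↔
      r.1.1 * (s.2 + 1) + s.1.2 * (r.2 + 1) < r.1.2 * (s.2 + 1) + s.1.1 * (r.2 + 1) := by
  rw [val, val, div_lt_div_iff₀ (by positivity) (by positivity), ← @Nat.cast_lt ℚ]
  push_cast
  constructor <;> intro h <;> linarith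

/-- Addition on rational codes. -/
def add (r s : RatCode) : RatCode :=
  ((r.1.1 * (s.2 + 1) + s.1.1 * (r.2 + 1), r.1.2 * (s.2 + 1) + s.1.2 * (r.2 + 1)),
    r.2 * (s.2 + 1) + s.2)

theorem val_add (r s : RatCode) : (r.add s).val = r.val + s.val := by
  have hden : ((r.2 * (s.2 + 1) + s.2 : ℕ) : ℚ) + 1 = (r.2 + 1) * (s.2 + 1) := by
    push_cast
    ring
  rw [val, val, val, add, hden]
  push_cast
  field_simp
  ring

theorem primrec_cross_mul {p q : RatCode → ℕ} (hp : Primrec p) (hq : Primrec q) :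
    Primrec fun x : RatCode × RatCode => p x.1 * (x.2.2 + 1) + q x.2 * (x.1.2 + 1) :=
  Primrec.nat_add.comp
    (Primrec.nat_mul.comp (hp.comp .fst) (Primrec.succ.comp (Primrec.snd.comp .snd)))
    (Primrec.nat_mul.comp (hq.comp .snd) (Primrec.succ.comp (Primrec.snd.comp .fst)))

theorem primrecRel_val_lt : PrimrecRel fun r s : RatCode => r.val < s.val := by
  have pos : Primrec fun r : RatCode => r.1.1 := Primrec.fst.comp .fst
  have neg : Primrec fun r : RatCode => r.1.2 := Primrec.snd.comp .fst
  have lhs := primrec_cross_mul pos neg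
  have rhs := primrec_cross_mul neg pos
  exact PrimrecPred.of_eq (Primrec.nat_lt.comp lhs rhs) fun x => (val_lt_val_iff x.1 x.2).symm

theorem primrec₂_add : Primrec₂ add := by
  have pos : Primrec fun r : RatCode => r.1.1 := Primrec.fst.comp .fst
  have neg : Primrec fun r : RatCode => r.1.2 := Primrec.snd.comp .fst
  have den : Primrec fun x : RatCode × RatCode => x.1.2 * (x.2.2 + 1) + x.2.2 :=
    Primrec.nat_add.comp (Primrec.nat_mul.comp (Primrec.snd.comp .fst)
      (Primrec.succ.comp (Primrec.snd.comp .snd))) (Primrec.snd.comp .snd)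
  exact ((primrec_cross_mul pos pos).pair (primrec_cross_mul neg neg)).pair den

/-- Negation of rational codes. -/
def neg (r : RatCode) : RatCode := ((r.1.2, r.1.1), r.2)

theorem val_neg (r : RatCode) : r.neg.val = -r.val := by
  rw [val, val, neg, ← neg_div, neg_sub]

theorem primrec_neg : Primrec neg :=
  ((Primrec.snd.comp .fst).pair (Primrec.fst.comp .fst)).pair .snd

/-- The sum of a list of rational codes. -/
def sum (l : List RatCode) : RatCode := l.foldr add ((0, 0), 0)

theorem val_sum (l : List RatCode) : (sum l).val = (l.map val).sum := by
  induction l with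
  | nil => simp [sum, val]
  | cons r l ih => rw [List.map_cons, List.sum_cons, ← ih, ← val_add]; rfl

theorem primrec_sum : Primrec sum :=
  Primrec.list_foldr .id (.const _) (primrec₂_add.comp (Primrec.fst.comp .snd)
    (Primrec.snd.comp .snd)).to₂

theorem exists_lt_val_and_sum_lt {ι : Type*} (s : Finset ι) (a : ι → ℝ) {b : ℝ}
    (h : ∑ i ∈ s, a i < b) :
    ∃ c : ι → RatCode, (∀ i, a i < (c i).val) ∧ ∑ i ∈ s, ((c i).val : ℝ) < b := by
  set ε := (b - ∑ i ∈ s, a i) / (s.card + 1) with hε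
  have hε0 : 0 < ε := div_pos (sub_pos.2 h) (by positivity)
  choose c hac hcε using fun i => exists_between_val (lt_add_of_pos_right (a i) hε0)
  refine ⟨c, hac, ?_⟩
  calc ∑ i ∈ s, ((c i).val : ℝ) ≤ ∑ i ∈ s, (a i + ε) := Finset.sum_le_sum fun i _ => (hcε i).le
    _ = ∑ i ∈ s, a i + s.card * ε := by simp [Finset.sum_add_distrib]
    _ < ∑ i ∈ s, a i + (s.card + 1) * ε := by linarith
    _ = b := by rw [hε]; field_simp; ring

theorem exists_val_lt_and_lt_sum {ι : Type*} (s : Finset ι) (a : ι → ℝ) {b : ℝ}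
    (h : b < ∑ i ∈ s, a i) :
    ∃ c : ι → RatCode, (∀ i, (c i).val < a i) ∧ b < ∑ i ∈ s, ((c i).val : ℝ) := by
  obtain ⟨c, hc, hsum⟩ := exists_lt_val_and_sum_lt s (fun i => -a i) (b := -b) (by simpa using h)
  refine ⟨fun i => (c i).neg, fun i => ?_, ?_⟩
  · simpa [val_neg] using neg_lt.1 (hc i)
  · simpa [val_neg] using lt_neg.1 hsum

end RatCode

end RationalCodes

section BinarySequences

/-- The initial segment of length `n` of an infinite binary sequence. -/
def initSeg (ω : Cantor) (n : ℕ) : List Bool := (List.range n).map ω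

@[simp]
theorem length_initSeg (ω : Cantor) (n : ℕ) : (initSeg ω n).length = n := by
  simp [initSeg]

theorem isPrefix_initSeg (ω : Cantor) (n : ℕ) : IsPrefix (initSeg ω n) ω := by
  intro i hi
  simp [initSeg]

theorem isPrefix_iff_eq_initSeg {x : List Bool} {ω : Cantor} :
    IsPrefix x ω ↔ x = initSeg ω x.length := by
  constructor
  · intro h
    refine List.ext_getElem (by simp) fun i h1 h2 => ?_
    rw [h i h1, isPrefix_initSeg ω _ i h2]
  · intro h
    rw [h]
    exact isPrefix_initSeg _ _

theorem initSeg_prefix_initSeg {ω : Cantor} {m n : ℕ} (h : m ≤ n) :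
    initSeg ω m <+: initSeg ω n := by
  rw [List.prefix_iff_eq_take, length_initSeg, initSeg, initSeg, ← List.map_take, List.take_range,
    min_eq_left h]

namespace IsPrefix

variable {x y : List Bool} {ω : Cantor}

theorem of_prefix (hy : IsPrefix y ω) (h : x <+: y) : IsPrefix x ω := by
  intro i hi
  rw [h.getElem hi]
  exact hy i _

theorem prefix_of_length_le (hx : IsPrefix x ω) (hy : IsPrefix y ω) (h : x.length ≤ y.length) :
    x <+: y := by
  rw [isPrefix_iff_eq_initSeg.1 hx, isPrefix_iff_eq_initSeg.1 hy]
  exact initSeg_prefix_initSeg h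

theorem prefix_initSeg (hx : IsPrefix x ω) {n : ℕ} (h : x.length ≤ n) : x <+: initSeg ω n :=
  hx.prefix_of_length_le (isPrefix_initSeg ω n) (by simpa using h)

end IsPrefix

theorem primrecRel_prefix : PrimrecRel fun x y : List Bool => x <+: y :=
  PrimrecPred.of_eq (p := fun z : List Bool × List Bool => z.1 = z.2.take z.1.length)
    (Primrec.eq.comp .fst (Primrec.list_take.comp (Primrec.list_length.comp .fst) .snd))
    fun _ => List.prefix_iff_eq_take.symm

theorem isOpen_cylinder (x : List Bool) : IsOpen (cylinder x) := by
  have hinter : cylinder x = ⋂ i : Fin x.length, {ω : Cantor | ω i = x[i]} := by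
    ext ω
    simp only [cylinder, IsPrefix, mem_ofPred_eq, mem_iInter]
    exact ⟨fun h i => (h i i.2).symm, fun h i hi => (h ⟨i, hi⟩).symm⟩
  rw [hinter]
  exact isOpen_iInter_of_finite fun i =>
    (isOpen_discrete {x[i]}).preimage (f := fun ω : Cantor => ω i) (continuous_apply (i : ℕ))

end BinarySequences

section EffectivelyOpen

variable {A B : Type*} [Primcodable A] [Primcodable B]

/-- A family of subsets of Cantor space is effectively open if its members are unions of intervals
that are recursively enumerable uniformly in the parameter. Other parameters than natural numbers
(rational codes, tuples) make the class closed under effective unions and bounded intersections. -/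
def EffectivelyOpen (U : A → Set Cantor) : Prop :=
  ∃ S : A × List Bool → Prop, REPred S ∧ ∀ a ω, ω ∈ U a ↔ ∃ x, IsPrefix x ω ∧ S (a, x)

theorem EffectivelyOpen.of_rePred {p : A → Prop} (hp : REPred p) :
    EffectivelyOpen fun a => {_ω | p a} :=
  ⟨fun x => p x.1, rePred_comp hp .fst, fun _ _ =>
    ⟨fun h => ⟨[], fun i hi => by simp at hi, h⟩, fun ⟨_, _, h⟩ => h⟩⟩

namespace EffectivelyOpen

variable {U : A → Set Cantor}

theorem exists_monotone (hU : EffectivelyOpen U) :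
    ∃ S : A × List Bool → Prop, REPred S ∧ (∀ a x y, x <+: y → S (a, x) → S (a, y)) ∧
      ∀ a ω, ω ∈ U a ↔ ∃ x, IsPrefix x ω ∧ S (a, x) := by
  obtain ⟨S, hS, hUS⟩ := hU
  refine ⟨fun p => ∃ z, z <+: p.2 ∧ S (p.1, z), ?_, ?_, fun a ω => (hUS a ω).trans ?_⟩
  · exact rePred_exists (p := fun q : (A × List Bool) × List Bool => q.2 <+: q.1.2 ∧ S (q.1.1, q.2))
      (rePred_and (rePred_of_primrecPred
        (primrecRel_prefix.comp Primrec.snd (Primrec.snd.comp Primrec.fst)))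
        (rePred_comp hS ((Primrec.fst.comp Primrec.fst).pair Primrec.snd).to_comp))
  · rintro a x y hxy ⟨z, hz, hSz⟩
    exact ⟨z, hz.trans hxy, hSz⟩
  · constructor
    · rintro ⟨x, hx, hSx⟩
      exact ⟨x, hx, x, List.prefix_rfl, hSx⟩
    · rintro ⟨x, hx, z, hz, hSz⟩
      exact ⟨z, hx.of_prefix hz, hSz⟩

theorem comp {U : B → Set Cantor} (hU : EffectivelyOpen U) {g : A → B} (hg : Computable g) :
    EffectivelyOpen fun a => U (g a) := by
  obtain ⟨S, hS, hUS⟩ := hU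
  exact ⟨fun p => S (g p.1, p.2), rePred_comp hS ((hg.comp .fst).pair .snd), fun a => hUS (g a)⟩

theorem of_eq {V : A → Set Cantor} (hU : EffectivelyOpen U) (h : ∀ a, U a = V a) :
    EffectivelyOpen V :=
  funext h ▸ hU

theorem inter {V : A → Set Cantor} (hU : EffectivelyOpen U) (hV : EffectivelyOpen V) :
    EffectivelyOpen fun a => U a ∩ V a := by
  obtain ⟨S, hS, hSmono, hUS⟩ := hU.exists_monotone
  obtain ⟨S', hS', hSmono', hVS'⟩ := hV.exists_monotone
  refine ⟨fun p => S p ∧ S' p, rePred_and hS hS', fun a ω => ?_⟩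
  rw [mem_inter_iff, hUS, hVS']
  constructor
  · rintro ⟨⟨x, hx, hSx⟩, y, hy, hSy⟩
    rcases le_total x.length y.length with hl | hl
    · exact ⟨y, hy, hSmono _ _ _ (hx.prefix_of_length_le hy hl) hSx, hSy⟩
    · exact ⟨x, hx, hSx, hSmono' _ _ _ (hy.prefix_of_length_le hx hl) hSy⟩
  · rintro ⟨x, hx, hSx, hSx'⟩
    exact ⟨⟨x, hx, hSx⟩, x, hx, hSx'⟩

theorem iUnion {U : A × B → Set Cantor} (hU : EffectivelyOpen U) :
    EffectivelyOpen fun a => ⋃ b, U (a, b) := by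
  obtain ⟨S, hS, hUS⟩ := hU
  refine ⟨fun p => ∃ b, S ((p.1, b), p.2), ?_, fun a ω => ?_⟩
  · exact rePred_exists (p := fun q : (A × List Bool) × B => S ((q.1.1, q.2), q.1.2))
      (rePred_comp hS (((Primrec.fst.comp Primrec.fst).pair Primrec.snd).pair
        (Primrec.snd.comp Primrec.fst)).to_comp)
  · simp only [mem_iUnion, hUS, ← exists_and_left]
    exact exists_comm

theorem iInter_mem_list {U : A × B → Set Cantor} (hU : EffectivelyOpen U) :
    EffectivelyOpen fun p : A × List B => ⋂ b ∈ p.2, U (p.1, b) := by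
  obtain ⟨S, hS, hSmono, hUS⟩ := hU.exists_monotone
  refine ⟨fun p => ∀ b ∈ p.1.2, S ((p.1.1, b), p.2), ?_, fun p ω => ?_⟩
  · have hpointwise : REPred fun q : (A × List Bool) × B => S ((q.1.1, q.2), q.1.2) :=
      rePred_comp hS (((Primrec.fst.comp Primrec.fst).pair Primrec.snd).pair
        (Primrec.snd.comp Primrec.fst)).to_comp
    exact rePred_comp (rePred_forall_mem_list hpointwise)
      (g := fun p : (A × List B) × List Bool => ((p.1.1, p.2), p.1.2))
      (((Primrec.fst.comp Primrec.fst).pair Primrec.snd).pair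
        (Primrec.snd.comp Primrec.fst)).to_comp
  · simp only [mem_iInter, hUS]
    constructor
    · intro h
      classical
      choose! x hx hSx using h
      set m := p.2.toFinset.sup fun b => (x b).length
      refine ⟨initSeg ω m, isPrefix_initSeg _ _, fun b hb => hSmono _ _ _ ?_ (hSx b hb)⟩
      exact (hx b hb).prefix_initSeg
        (Finset.le_sup (f := fun b => (x b).length) (List.mem_toFinset.2 hb))
    · rintro ⟨x, hx, hSx⟩ b hb
      exact ⟨x, hx, hSx b hb⟩

theorem iInter_lt {U : A × ℕ → Set Cantor} (hU : EffectivelyOpen U) :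
    EffectivelyOpen fun p : A × ℕ => ⋂ i < p.2, U (p.1, i) :=
  (hU.iInter_mem_list.comp (g := fun p : A × ℕ => (p.1, List.range p.2))
    (Primrec.fst.pair (Primrec.list_range.comp .snd)).to_comp).of_eq fun p => by simp

theorem isOpen (hU : EffectivelyOpen U) (a : A) : IsOpen (U a) := by
  obtain ⟨S, -, hUS⟩ := hU
  have : U a = ⋃ x ∈ {x | S (a, x)}, cylinder x := by
    ext ω
    simp [hUS, cylinder, and_comm]
  rw [this]
  exact isOpen_biUnion fun x _ => isOpen_cylinder x

theorem uniformlyEffectivelyOpen {U : ℕ → Set Cantor} (hU : EffectivelyOpen U) :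
    UniformlyEffectivelyOpen U := by
  obtain ⟨S, hS, hUS⟩ := hU
  obtain ⟨s, hs, hSs⟩ := rePred_iff_exists_primrecRel.1 hS
  classical
  let enum : ℕ → ℕ → Option (List Bool) := fun n i =>
    (decode (α := List Bool × ℕ) i).bind fun p => if s (n, p.1) p.2 then some p.1 else none
  have henum : Primrec₂ enum :=
    Primrec.option_bind (Primrec.decode.comp .snd) (Primrec.ite
      (hs.comp ((Primrec.fst.comp .fst).pair (Primrec.fst.comp .snd)) (Primrec.snd.comp .snd))
      (Primrec.option_some.comp (Primrec.fst.comp .snd)) (.const none))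
  refine ⟨fun n i => (enum n i : Part (List Bool)), henum.to_comp.ofOption, fun n => ?_⟩
  ext ω
  rw [hUS]
  constructor
  · rintro ⟨x, hx, hSx⟩
    obtain ⟨k, hk⟩ := (hSs _).1 hSx
    exact ⟨encode (x, k), x, by simp [enum, hk], hx⟩
  · rintro ⟨i, x, hxi, hx⟩
    obtain ⟨⟨y, k⟩, -, hy⟩ := Option.bind_eq_some_iff.1 (Part.mem_coe.1 hxi)
    obtain ⟨hk, rfl⟩ : s (n, y) k ∧ y = x := by simpa using hy
    exact ⟨y, hx, (hSs _).2 ⟨k, hk⟩⟩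

end EffectivelyOpen

theorem IsMartinLofRandom.exists_notMem {P : Measure Cantor} {ω : Cantor}
    (hω : IsMartinLofRandom P ω) {U : ℕ → Set Cantor} (hU : EffectivelyOpen U)
    (hPU : ∀ n, P (U n) ≤ (2⁻¹ : ENNReal) ^ n) : ∃ n, ω ∉ U n := by
  simpa using hω U ⟨hU.uniformlyEffectivelyOpen, hPU⟩

end EffectivelyOpen

section ComputableTransformation

theorem ComputableTransformation.exists_rePred {T : Cantor → Cantor}
    (hT : ComputableTransformation T) :
    ∃ R : Set (List Bool × List Bool), REPred (· ∈ R) ∧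
      ∀ y ω, IsPrefix y (T ω) ↔ ∃ x, IsPrefix x ω ∧ (x, y) ∈ R := by
  obtain ⟨R, hR, hTR⟩ := hT
  refine ⟨R, hR.re, fun y ω => ⟨fun hy => ?_, fun ⟨x, hx, hxy⟩ => (hTR ω).1 x y hx hxy⟩⟩
  obtain ⟨x, z, hx, hxz, hlen⟩ := (hTR ω).2 y.length
  exact ⟨x, hx, hR.closed x z y hxz (hy.prefix_of_length_le ((hTR ω).1 x z hx hxz) hlen)⟩

theorem isPrefix_iterate_iff {R : Set (List Bool × List Bool)} {T : Cantor → Cantor}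
    (hR : ∀ y ω, IsPrefix y (T ω) ↔ ∃ x, IsPrefix x ω ∧ (x, y) ∈ R) {y : List Bool} {n : ℕ}
    {ω : Cantor} : IsPrefix y (T^[n] ω) ↔ ∃ x, IsPrefix x ω ∧ StepsTo R n x y := by
  induction n generalizing ω with
  | zero => simp [StepsTo]
  | succ n ih =>
    simp only [iterate_succ_apply, ih, hR, StepsTo]
    grind

theorem EffectivelyOpen.preimage_iterate {A : Type*} [Primcodable A] {U : A → Set Cantor}
    (hU : EffectivelyOpen U) {T : Cantor → Cantor} (hT : ComputableTransformation T) :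
    EffectivelyOpen fun p : A × ℕ => T^[p.2] ⁻¹' U p.1 := by
  obtain ⟨S, hS, hUS⟩ := hU
  obtain ⟨R, hR, hTR⟩ := hT.exists_rePred
  have hre : REPred fun q : ((A × ℕ) × List Bool) × List Bool =>
      StepsTo R q.1.1.2 q.1.2 q.2 ∧ S (q.1.1.1, q.2) :=
    rePred_and
      (rePred_comp (rePred_stepsTo hR)
        (g := fun q : ((A × ℕ) × List Bool) × List Bool => (q.1.1.2, (q.1.2, q.2)))
        ((Primrec.snd.comp (Primrec.fst.comp .fst)).pair
          ((Primrec.snd.comp .fst).pair .snd)).to_comp)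
      (rePred_comp hS ((Primrec.fst.comp (Primrec.fst.comp .fst)).pair .snd).to_comp)
  refine ⟨_, rePred_exists hre, fun p ω => ?_⟩
  simp only [mem_preimage, hUS, isPrefix_iterate_iff hTR]
  grind

end ComputableTransformation

section SemicomputableFunctions

namespace SimpleCode

theorem eval_cons (p : List Bool × RatCode) (c : SimpleCode) (ω : Cantor) :
    eval (p :: c) ω = if IsPrefix p.1 ω then p.2.val else eval c ω :=
  rfl

/-- The value of a simple function on `Γ_x`, correct when `x` is at least as long as all strings
listed in the code. -/
def evalOn (c : SimpleCode) (x : List Bool) : RatCode :=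
  c.foldr (fun p r => if p.1 <+: x then p.2 else r) ((0, 0), 0)

theorem primrec₂_evalOn : Primrec₂ evalOn :=
  Primrec.list_foldr (f := fun q : SimpleCode × List Bool => q.1)
    (h := fun q p => if p.1.1 <+: q.2 then p.1.2 else p.2) .fst (.const _)
    (Primrec.ite (primrecRel_prefix.comp (Primrec.fst.comp (Primrec.fst.comp .snd))
      (Primrec.snd.comp .fst)) (Primrec.snd.comp (Primrec.fst.comp .snd)) (Primrec.snd.comp .snd))

theorem eval_eq_val_evalOn {c : SimpleCode} {x : List Bool} {ω : Cantor} (hx : IsPrefix x ω)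
    (hc : ∀ p ∈ c, p.1.length ≤ x.length) : c.eval ω = (c.evalOn x).val := by
  induction c with
  | nil => simp [eval, evalOn, RatCode.val]
  | cons p c ih =>
    have hp : IsPrefix p.1 ω ↔ p.1 <+: x :=
      ⟨fun h => h.prefix_of_length_le hx (hc p (by simp)), hx.of_prefix⟩
    rw [eval_cons, ih fun q hq => hc q (by simp [hq]), evalOn, evalOn, List.foldr_cons,
      apply_ite RatCode.val]
    simp only [hp]

/-- The code of the negated simple function. -/
def neg (c : SimpleCode) : SimpleCode := c.map fun p => (p.1, p.2.neg)

theorem eval_neg (c : SimpleCode) (ω : Cantor) : c.neg.eval ω = -c.eval ω := by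
  induction c with
  | nil => simp [neg, eval]
  | cons p c ih =>
    rw [neg, List.map_cons, eval_cons, eval_cons, ← neg, ih, RatCode.val_neg, apply_ite Neg.neg]

theorem primrec_neg : Primrec neg :=
  Primrec.list_map .id (Primrec.pair (Primrec.fst.comp .snd)
    (RatCode.primrec_neg.comp (Primrec.snd.comp .snd))).to₂

theorem effectivelyOpen_exists_eval_lt {h : ℕ → SimpleCode} (hh : Computable h) :
    EffectivelyOpen fun r : RatCode => {ω | ∃ m, (h m).eval ω < r.val} := by
  let S : SimpleCode × (RatCode × List Bool) → Prop := fun p =>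
    (∀ y ∈ p.1, y.1.length ≤ p.2.2.length) ∧ (p.1.evalOn p.2.2).val < p.2.1.val
  have hS : PrimrecPred S := by
    refine PrimrecPred.and ?_ (RatCode.primrecRel_val_lt.comp
      (primrec₂_evalOn.comp .fst (Primrec.snd.comp .snd)) (Primrec.fst.comp .snd))
    have hlength : PrimrecRel fun (y : List Bool × RatCode) (p : RatCode × List Bool) =>
        y.1.length ≤ p.2.length :=
      Primrec.nat_le.comp (Primrec.list_length.comp (Primrec.fst.comp .fst))
        (Primrec.list_length.comp (Primrec.snd.comp .snd))
    exact hlength.forall_mem_list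
  have hre : REPred fun q : (RatCode × List Bool) × ℕ => S (h q.2, q.1) :=
    rePred_comp (rePred_of_primrecPred hS) ((hh.comp .snd).pair .fst)
  refine ⟨_, rePred_exists hre, fun r ω => ⟨?_, ?_⟩⟩
  · rintro ⟨m, hm⟩
    set n := (h m).toFinset.sup fun y => y.1.length
    have hlen : ∀ y ∈ h m, y.1.length ≤ (initSeg ω n).length := fun y hy => by
      rw [length_initSeg]
      exact Finset.le_sup (f := fun y : List Bool × RatCode => y.1.length) (List.mem_toFinset.2 hy)
    rw [eval_eq_val_evalOn (isPrefix_initSeg ω n) hlen] at hm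
    exact ⟨_, isPrefix_initSeg ω n, m, hlen, hm⟩
  · rintro ⟨x, hx, m, hlen, hm⟩
    rw [← eval_eq_val_evalOn hx hlen] at hm
    exact ⟨m, hm⟩

end SimpleCode

/-- A real function on Cantor space is effectively upper semicontinuous if its strict sublevel sets
at rational levels are effectively open, uniformly in the level. -/
def EffectivelyUpperSemicontinuous (f : Cantor → ℝ) : Prop :=
  EffectivelyOpen fun r : RatCode => {ω | f ω < r.val}

variable {f : Cantor → ℝ}

theorem UpperSemicomputableFun.effectivelyUpperSemicontinuous (hf : UpperSemicomputableFun f) :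
    EffectivelyUpperSemicontinuous f := by
  obtain ⟨h, hh, hanti, hlim⟩ := hf
  refine (SimpleCode.effectivelyOpen_exists_eval_lt hh).of_eq fun r => ?_
  have hle : ∀ m ω, f ω ≤ ((h m).eval ω : ℝ) := fun m ω =>
    (antitone_nat_of_succ_le (f := fun n => (((h n).eval ω : ℚ) : ℝ))
      fun n => by exact_mod_cast hanti n ω).le_of_tendsto (hlim ω) m
  ext ω
  constructor
  · rintro ⟨m, hm⟩
    exact (hle m ω).trans_lt (Rat.cast_lt.2 hm)
  · intro hω
    obtain ⟨m, hm⟩ := ((hlim ω).eventually (gt_mem_nhds hω)).exists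
    exact ⟨m, Rat.cast_lt.1 hm⟩

theorem LowerSemicomputableFun.neg (hf : LowerSemicomputableFun f) :
    UpperSemicomputableFun (-f) := by
  obtain ⟨h, hh, hmono, hlim⟩ := hf
  refine ⟨fun n => (h n).neg, SimpleCode.primrec_neg.to_comp.comp hh, fun n ω => ?_, fun ω => ?_⟩
  · simpa only [SimpleCode.eval_neg, neg_le_neg_iff] using hmono n ω
  · simpa only [SimpleCode.eval_neg, Rat.cast_neg, Pi.neg_apply] using (hlim ω).neg

theorem UpperSemicomputableFun.neg (hf : UpperSemicomputableFun f) :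
    LowerSemicomputableFun (-f) := by
  obtain ⟨h, hh, hanti, hlim⟩ := hf
  refine ⟨fun n => (h n).neg, SimpleCode.primrec_neg.to_comp.comp hh, fun n ω => ?_, fun ω => ?_⟩
  · simpa only [SimpleCode.eval_neg, neg_le_neg_iff] using hanti n ω
  · simpa only [SimpleCode.eval_neg, Rat.cast_neg, Pi.neg_apply] using (hlim ω).neg

theorem ComputableFun.neg (hf : ComputableFun f) : ComputableFun (-f) :=
  ⟨hf.2.neg, hf.1.neg⟩

namespace EffectivelyUpperSemicontinuous

theorem sub_const (hf : EffectivelyUpperSemicontinuous f) (q : ℚ) :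
    EffectivelyUpperSemicontinuous fun ω => f ω - q := by
  obtain ⟨s, rfl⟩ := RatCode.exists_val_eq q
  refine (EffectivelyOpen.comp hf
    (RatCode.primrec₂_add.comp .id (.const s)).to_comp).of_eq fun r => ?_
  simp [RatCode.val_add, sub_lt_iff_lt_add]

theorem upperSemicontinuous (hf : EffectivelyUpperSemicontinuous f) : UpperSemicontinuous f := by
  refine upperSemicontinuous_iff_isOpen_preimage.2 fun b => ?_
  have : f ⁻¹' Iio b = ⋃ r : {r : RatCode // r.val < b}, {ω | f ω < r.1.val} := by
    ext ω
    simp only [mem_preimage, mem_Iio, mem_iUnion, mem_ofPred_eq, Subtype.exists]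
    constructor
    · intro hω
      obtain ⟨r, hr, hrb⟩ := RatCode.exists_between_val hω
      exact ⟨r, hrb, hr⟩
    · rintro ⟨r, hrb, hr⟩
      exact hr.trans hrb
  rw [this]
  exact isOpen_iUnion fun r => EffectivelyOpen.isOpen hf r.1

theorem birkhoffSum (hf : EffectivelyUpperSemicontinuous f) {T : Cantor → Cantor}
    (hT : ComputableTransformation T) :
    EffectivelyOpen fun q : ℕ × RatCode => {ω | birkhoffSum T f q.1 ω < q.2.val} := by
  have hterm : EffectivelyOpen fun x : List RatCode × ℕ =>
      {ω | f (T^[x.2] ω) < (x.1.getD x.2 default).val} :=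
    (EffectivelyOpen.preimage_iterate hf hT).comp
      (g := fun x : List RatCode × ℕ => (x.1.getD x.2 default, x.2))
      (Primrec.pair (Primrec.list_getD default) .snd).to_comp
  have hterms : EffectivelyOpen fun x : (ℕ × RatCode) × List RatCode =>
      ⋂ i < x.1.1, {ω | f (T^[i] ω) < (x.2.getD i default).val} :=
    hterm.iInter_lt.comp (g := fun x : (ℕ × RatCode) × List RatCode => (x.2, x.1.1))
      (Primrec.snd.pair (Primrec.fst.comp .fst)).to_comp
  have hbudget : EffectivelyOpen fun x : (ℕ × RatCode) × List RatCode =>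
      {_ω : Cantor | x.2.length = x.1.1 ∧ (RatCode.sum x.2).val < x.1.2.val} :=
    .of_rePred (rePred_of_primrecPred (PrimrecPred.and
      (Primrec.eq.comp (Primrec.list_length.comp .snd) (Primrec.fst.comp .fst))
      (RatCode.primrecRel_val_lt.comp (RatCode.primrec_sum.comp .snd) (Primrec.snd.comp .fst))))
  refine (hterms.inter hbudget).iUnion.of_eq fun ⟨n, r⟩ => ?_
  ext ω
  simp only [mem_iUnion, mem_inter_iff, mem_iInter, mem_ofPred_eq]
  constructor
  · rintro ⟨l, hl, rfl, hsum⟩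
    refine lt_of_le_of_lt ?_ (Rat.cast_lt.2 hsum)
    rw [RatCode.val_sum, ← Fin.sum_univ_fun_getElem, Rat.cast_sum, _root_.birkhoffSum,
      Finset.sum_range]
    exact Finset.sum_le_sum fun i _ => by simpa using (hl i i.2).le
  · intro hω
    obtain ⟨c, hc, hsum⟩ :=
      RatCode.exists_lt_val_and_sum_lt (Finset.range n) (fun i => f (T^[i] ω)) hω
    refine ⟨(List.range n).map c, fun i hi => ?_, by simp, ?_⟩
    · simpa [hi] using hc i
    · rw [RatCode.val_sum, List.map_map, ← List.sum_toFinset _ List.nodup_range,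
        List.toFinset_range, ← Rat.cast_lt (K := ℝ), Rat.cast_sum]
      exact hsum

end EffectivelyUpperSemicontinuous

theorem ComputableFun.continuous (hf : ComputableFun f) : Continuous f := by
  refine continuous_iff_lower_upperSemicontinuous.2
    ⟨?_, hf.2.effectivelyUpperSemicontinuous.upperSemicontinuous⟩
  simpa [comp_def] using continuous_neg.comp_upperSemicontinuous_antitone
    hf.neg.2.effectivelyUpperSemicontinuous.upperSemicontinuous fun _ _ => neg_le_neg

end SemicomputableFunctions

section Schedules

/-- `l` is a list of disjoint integer intervals `(u, v]`, in increasing order, inside `(k, n]`. -/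
def Schedule (n : ℕ) : ℕ → List (ℕ × ℕ) → Prop
  | _, [] => True
  | k, p :: l => k ≤ p.1 ∧ p.1 < p.2 ∧ p.2 ≤ n ∧ Schedule n p.2 l

/-- The profit made by buying at price `a u` and selling at price `b v` for each `(u, v)` in `l`. -/
def profit (a b : ℕ → ℝ) (l : List (ℕ × ℕ)) : ℝ := (l.map fun p => b p.2 - a p.1).sum

/-- The largest profit of a schedule with at most `N` intervals up to time `n`. -/
noncomputable def maxProfit (a b : ℕ → ℝ) (N n : ℕ) : ℝ :=
  ⨆ s : {l : List (ℕ × ℕ) // Schedule n 0 l ∧ l.length ≤ N}, profit a b s.1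

/-- The schedule moved one unit of time to the left. -/
def shiftSchedule (l : List (ℕ × ℕ)) : List (ℕ × ℕ) := l.map fun p => (p.1 - 1, p.2 - 1)

variable {a b a' b' : ℕ → ℝ} {k n N : ℕ} {l s : List (ℕ × ℕ)}

@[simp]
theorem profit_nil (a b : ℕ → ℝ) : profit a b [] = 0 := rfl

@[simp]
theorem profit_cons (a b : ℕ → ℝ) (p : ℕ × ℕ) (l : List (ℕ × ℕ)) :
    profit a b (p :: l) = b p.2 - a p.1 + profit a b l := by
  simp [profit]

@[simp]
theorem length_shiftSchedule (l : List (ℕ × ℕ)) : (shiftSchedule l).length = l.length := by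
  simp [shiftSchedule]

namespace Schedule

theorem mono {m : ℕ} (hnm : n ≤ m) (h : Schedule n k l) : Schedule m k l := by
  induction l generalizing k with
  | nil => trivial
  | cons p l ih => exact ⟨h.1, h.2.1, h.2.2.1.trans hnm, ih h.2.2.2⟩

-- Compare the first interval `p` of `l` with the first upcrossings `q` and `r` of `s`: either `q`
-- ends before `p` starts and can be prepended, or `p` can be cut into two intervals by selling at
-- the end of `q` and buying back at the start of `r`, or `r` starts after `p` and we recurse.
theorem exists_insert (hl : Schedule n k l) (hs : Schedule n k s)
    (hup : ∀ p ∈ s, a p.1 < 0 ∧ 0 < b p.2) (hlen : l.length < s.length) :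
    ∃ t, Schedule n k t ∧ t.length = l.length + 1 ∧ profit a b l ≤ profit a b t := by
  induction l generalizing k s with
  | nil =>
    obtain ⟨p, s, rfl⟩ := List.exists_cons_of_length_pos hlen
    refine ⟨[p], ⟨hs.1, hs.2.1, hs.2.2.1, trivial⟩, rfl, ?_⟩
    have hp := hup p (by simp)
    simp only [profit_nil, profit_cons]
    linarith
  | cons p l ih =>
    match s, hlen with
    | [q], hlen => simp at hlen
    | q :: r :: s, hlen =>
      have hq := hup q (by simp)
      have hr := hup r (by simp)
      rcases le_or_gt q.2 p.1 with hqp | hpq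
      · refine ⟨q :: p :: l, ⟨hs.1, hs.2.1, hs.2.2.1, hqp, hl.2⟩, rfl, ?_⟩
        simp only [profit_cons]
        linarith
      rcases lt_or_ge r.1 p.2 with hrp | hpr
      · refine ⟨(p.1, q.2) :: (r.1, p.2) :: l,
          ⟨hl.1, hpq, hs.2.2.1, hs.2.2.2.1, hrp, hl.2.2⟩, rfl, ?_⟩
        simp only [profit_cons]
        linarith
      · obtain ⟨t, ht, hlent, hprofit⟩ := ih (k := p.2) (s := r :: s) hl.2.2.2
          ⟨hpr, hs.2.2.2.2⟩ (fun q' hq' => hup q' (List.mem_cons_of_mem _ hq'))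
          (by simpa using hlen)
        refine ⟨p :: t, ⟨hl.1, hl.2.1, hl.2.2.1, ht⟩, by simp [hlent], ?_⟩
        simpa using hprofit

theorem exists_length_eq (hl : Schedule n k l) (hs : Schedule n k s)
    (hup : ∀ p ∈ s, a p.1 < 0 ∧ 0 < b p.2) (hlen : l.length ≤ s.length) :
    ∃ t, Schedule n k t ∧ t.length = s.length ∧ profit a b l ≤ profit a b t := by
  obtain ⟨j, hj⟩ := Nat.exists_eq_add_of_le hlen
  induction j generalizing l with
  | zero => exact ⟨l, hl, hj.symm, le_rfl⟩
  | succ j ih =>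
    obtain ⟨t, ht, hlent, hlt⟩ := hl.exists_insert hs hup (by lia)
    obtain ⟨t', ht', hlent', htt'⟩ := ih ht (by lia) (by lia)
    exact ⟨t', ht', hlent', hlt.trans htt'⟩

theorem shift (h : Schedule n (k + 1) l) : Schedule n k (shiftSchedule l) := by
  induction l generalizing k with
  | nil => trivial
  | cons p l ih =>
    obtain ⟨hk, hp, hn, hl⟩ := h
    refine ⟨Nat.le_sub_of_add_le hk, by dsimp only; lia, by dsimp only; lia, ih ?_⟩
    rwa [Nat.sub_add_cancel (by lia)]

theorem profit_shiftSchedule {x y : ℝ} (ha : ∀ k, a (k + 1) = x + a' k)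
    (hb : ∀ k, b (k + 1) = y + b' k) (h : Schedule n (k + 1) l) :
    profit a' b' (shiftSchedule l) = profit a b l + l.length * (x - y) := by
  induction l generalizing k with
  | nil => simp [shiftSchedule]
  | cons p l ih =>
    obtain ⟨hk, hp, -, hl⟩ := h
    have hbuy : a p.1 = x + a' (p.1 - 1) := by rw [← ha, Nat.sub_add_cancel (by lia)]
    have hsell : b p.2 = y + b' (p.2 - 1) := by rw [← hb, Nat.sub_add_cancel (by lia)]
    have htail := ih (k := p.2 - 1) (by rwa [Nat.sub_add_cancel (by lia)])
    simp only [shiftSchedule, List.map_cons, profit_cons, List.length_cons] at htail ⊢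
    rw [htail, hbuy, hsell]
    push_cast
    ring

theorem exists_shift {x y : ℝ} (ha₀ : a 0 = 0) (ha'₀ : a' 0 = 0) (hb'₀ : b' 0 = 0)
    (ha : ∀ k, a (k + 1) = x + a' k) (hb : ∀ k, b (k + 1) = y + b' k) (h : Schedule n 0 l) :
    ∃ t, Schedule n 0 t ∧ t.length ≤ l.length ∧
      profit a b l + l.length * (x - y) ≤ profit a' b' t + max x 0 := by
  match l, h with
  | [], _ => exact ⟨[], trivial, le_rfl, by simp⟩
  | (u + 1, v) :: l, h =>
    have h' : Schedule n (0 + 1) ((u + 1, v) :: l) := ⟨by simp, h.2⟩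
    refine ⟨_, h'.shift, by simp, ?_⟩
    rw [h'.profit_shiftSchedule ha hb]
    exact le_add_of_nonneg_right (le_max_right x 0)
  | (0, v + 1) :: l, ⟨_, _, hn, hl⟩ =>
    have hprofit : profit a b ((0, v + 1) :: l) + ((0, v + 1) :: l).length * (x - y) =
        b' v + profit a' b' (shiftSchedule l) + x := by
      rw [profit_cons, profit_shiftSchedule ha hb hl, hb, ha₀, List.length_cons]
      push_cast
      ring
    rw [hprofit]
    rcases Nat.eq_zero_or_pos v with rfl | hv
    · refine ⟨shiftSchedule l, shift hl, by simp, ?_⟩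
      rw [hb'₀, zero_add]
      gcongr
      exact le_max_left x 0
    · refine ⟨(0, v) :: shiftSchedule l, ⟨le_rfl, hv, by lia, shift hl⟩, by simp, ?_⟩
      rw [profit_cons, ha'₀, sub_zero]
      gcongr
      exact le_max_left x 0

theorem abs_profit_le (h : Schedule n k l) :
    |profit a b l| ≤ l.length * ∑ j ∈ Finset.range (n + 1), (|a j| + |b j|) := by
  induction l generalizing k with
  | nil => simp
  | cons p l ih =>
    have hterm : ∀ {c : ℕ → ℝ} {j}, j ≤ n → |c j| ≤ ∑ j ∈ Finset.range (n + 1), |c j| := fun hj =>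
      Finset.single_le_sum (f := fun j => |_|) (fun _ _ => abs_nonneg _) (by simp; lia)
    obtain ⟨-, hp, hn, hl⟩ := h
    calc |profit a b (p :: l)| ≤ |b p.2| + |a p.1| + |profit a b l| := by
          rw [profit_cons]
          exact (abs_add_le _ _).trans (by gcongr; exact abs_sub _ _)
      _ ≤ ∑ j ∈ Finset.range (n + 1), |b j| + ∑ j ∈ Finset.range (n + 1), |a j| +
          l.length * ∑ j ∈ Finset.range (n + 1), (|a j| + |b j|) :=
        add_le_add (add_le_add (hterm hn) (hterm (hp.le.trans hn))) (ih hl)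
      _ = (p :: l).length * ∑ j ∈ Finset.range (n + 1), (|a j| + |b j|) := by
        rw [List.length_cons, Finset.sum_add_distrib]
        push_cast
        ring

theorem abs_profit_le_of_length_le (h : Schedule n k l) (hN : l.length ≤ N) :
    |profit a b l| ≤ N * ∑ j ∈ Finset.range (n + 1), (|a j| + |b j|) :=
  h.abs_profit_le.trans (by gcongr)

theorem profit_le_maxProfit (h : Schedule n 0 l) (hN : l.length ≤ N) :
    profit a b l ≤ maxProfit a b N n := by
  refine le_ciSup (f := fun s : {l // Schedule n 0 l ∧ l.length ≤ N} => profit a b s.1)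
    ⟨N * ∑ j ∈ Finset.range (n + 1), (|a j| + |b j|), ?_⟩ ⟨l, h, hN⟩
  rintro _ ⟨s, rfl⟩
  exact (le_abs_self _).trans (s.2.1.abs_profit_le_of_length_le s.2.2)

end Schedule

theorem maxProfit_le {c : ℝ} (h : ∀ l, Schedule n 0 l → l.length ≤ N → profit a b l ≤ c) :
    maxProfit a b N n ≤ c :=
  have : Nonempty {l // Schedule n 0 l ∧ l.length ≤ N} := ⟨⟨[], trivial, Nat.zero_le _⟩⟩
  ciSup_le fun s => h s.1 s.2.1 s.2.2

theorem abs_maxProfit_le (a b : ℕ → ℝ) (N n : ℕ) :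
    |maxProfit a b N n| ≤ N * ∑ j ∈ Finset.range (n + 1), (|a j| + |b j|) := by
  rw [abs_of_nonneg (Schedule.profit_le_maxProfit (l := []) trivial (Nat.zero_le N))]
  exact maxProfit_le fun l hl hN => (le_abs_self _).trans (hl.abs_profit_le_of_length_le hN)

end Schedules

section UpcrossingInequality

variable {X : Type*} {T : X → X} {f g h : X → ℝ}

/-- The points at which, up to time `n`, the Birkhoff sums of `g` and `h` admit `N` successive
upcrossings: times when the sum of `g` is negative, each followed by a time when the sum of `h` is
positive. For `g = f - α` and `h = f - β` these are the upcrossings of the Birkhoff averages of `f`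
from below `α` to above `β`. -/
def upcrossingSet (T : X → X) (g h : X → ℝ) (N n : ℕ) : Set X :=
  {ω | ∃ s, Schedule n 0 s ∧ s.length = N ∧
    ∀ p ∈ s, birkhoffSum T g p.1 ω < 0 ∧ 0 < birkhoffSum T h p.2 ω}

/-- The largest profit, up to time `n`, of `N` trades that buy at the Birkhoff sum of `g` and sell
at the Birkhoff sum of `h`. -/
noncomputable def maxBirkhoffProfit (T : X → X) (g h : X → ℝ) (N n : ℕ) (ω : X) : ℝ :=
  maxProfit (birkhoffSum T g · ω) (birkhoffSum T h · ω) N n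

theorem upcrossingSet_mono (T : X → X) (g h : X → ℝ) (N : ℕ) : Monotone (upcrossingSet T g h N) :=
  fun _ _ hnm _ ⟨s, hs, hup⟩ => ⟨s, hs.mono hnm, hup⟩

theorem maxBirkhoffProfit_add_indicator_le (hgh : h ≤ g) (N n : ℕ) (ω : X) :
    maxBirkhoffProfit T g h N n ω + N * (upcrossingSet T g h N n).indicator (g - h) ω ≤
      maxBirkhoffProfit T g h N n (T ω) + max (g ω) 0 := by
  have hstep : ∀ l, Schedule n 0 l → l.length ≤ N →
      profit (birkhoffSum T g · ω) (birkhoffSum T h · ω) l + l.length * (g ω - h ω) ≤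
        maxBirkhoffProfit T g h N n (T ω) + max (g ω) 0 := by
    intro l hl hN
    obtain ⟨t, ht, hlen, hprofit⟩ := hl.exists_shift (a := (birkhoffSum T g · ω))
      (b := (birkhoffSum T h · ω)) (birkhoffSum_zero T g ω) (birkhoffSum_zero T g (T ω))
      (birkhoffSum_zero T h (T ω)) (birkhoffSum_succ' T g · ω) (birkhoffSum_succ' T h · ω)
    exact hprofit.trans (by gcongr; exact ht.profit_le_maxProfit (hlen.trans hN))
  rw [← le_sub_iff_add_le]
  refine maxProfit_le fun l hl hN => ?_
  rw [le_sub_iff_add_le]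
  by_cases hω : ω ∈ upcrossingSet T g h N n
  · have ⟨s, hs, hsN, hup⟩ := hω
    obtain ⟨t, ht, hts, hprofit⟩ := hl.exists_length_eq (a := (birkhoffSum T g · ω))
      (b := (birkhoffSum T h · ω)) hs hup (hN.trans hsN.ge)
    have htN := hstep t ht (hts.trans hsN).le
    rw [hts, hsN] at htN
    rw [indicator_of_mem hω]
    exact (add_le_add_left hprofit _).trans htN
  · rw [indicator_of_notMem hω, mul_zero, add_zero]
    have hgap : 0 ≤ l.length * (g ω - h ω) := mul_nonneg (Nat.cast_nonneg _) (sub_nonneg.2 (hgh ω))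
    exact (le_add_of_nonneg_right hgap).trans (hstep l hl hN)

variable [MeasurableSpace X] {μ : Measure X}

theorem integrable_birkhoffSum (hT : MeasurePreserving T μ μ) (hg : Integrable g μ) (n : ℕ) :
    Integrable (birkhoffSum T g n) μ :=
  integrable_finsetSum _ fun i _ => (hT.iterate i).integrable_comp_of_integrable hg

theorem integrable_maxBirkhoffProfit (hT : MeasurePreserving T μ μ) (hg : Integrable g μ)
    (hh : Integrable h μ) (N n : ℕ) : Integrable (maxBirkhoffProfit T g h N n) μ := by
  have hprofit : ∀ l, AEMeasurable
      (fun ω => profit (birkhoffSum T g · ω) (birkhoffSum T h · ω) l) μ := by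
    intro l
    induction l with
    | nil => simp
    | cons p l ih =>
      simp only [profit_cons]
      exact ((integrable_birkhoffSum hT hh p.2).aemeasurable.sub
        (integrable_birkhoffSum hT hg p.1).aemeasurable).add ih
  have hbound : Integrable (fun ω => N * ∑ j ∈ Finset.range (n + 1),
      (|birkhoffSum T g j ω| + |birkhoffSum T h j ω|)) μ :=
    (integrable_finsetSum _ fun j _ => (integrable_birkhoffSum hT hg j).abs.add
      (integrable_birkhoffSum hT hh j).abs).const_mul _
  have hmeas : AEMeasurable (maxBirkhoffProfit T g h N n) μ :=
    AEMeasurable.iSup fun s : {l // Schedule n 0 l ∧ l.length ≤ N} => hprofit s.1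
  exact hbound.mono' hmeas.aestronglyMeasurable (.of_forall fun ω => abs_maxProfit_le _ _ N n)

theorem nullMeasurableSet_upcrossingSet (hT : MeasurePreserving T μ μ) (hg : Integrable g μ)
    (hh : Integrable h μ) (N n : ℕ) : NullMeasurableSet (upcrossingSet T g h N n) μ := by
  have : upcrossingSet T g h N n = ⋃ s ∈ {s | Schedule n 0 s ∧ s.length = N},
      ⋂ p ∈ {p | p ∈ s}, {ω | birkhoffSum T g p.1 ω < 0} ∩ {ω | 0 < birkhoffSum T h p.2 ω} := by
    ext ω
    simp [upcrossingSet, and_assoc]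
  rw [this]
  refine .biUnion (to_countable _) fun s _ => .biInter (to_countable _) fun p _ => .inter ?_ ?_
  · exact nullMeasurableSet_lt (integrable_birkhoffSum hT hg p.1).aemeasurable aemeasurable_const
  · exact nullMeasurableSet_lt aemeasurable_const (integrable_birkhoffSum hT hh p.2).aemeasurable

theorem mul_setIntegral_upcrossingSet_le (hT : MeasurePreserving T μ μ) (hg : Integrable g μ)
    (hh : Integrable h μ) (hgh : h ≤ g) (N n : ℕ) :
    N * ∫ ω in upcrossingSet T g h N n, (g - h) ω ∂μ ≤ ∫ ω, max (g ω) 0 ∂μ := by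
  set m := maxBirkhoffProfit T g h N n
  have hm : Integrable m μ := integrable_maxBirkhoffProfit hT hg hh N n
  have hmT : Integrable (fun ω => m (T ω)) μ := hT.integrable_comp_of_integrable hm
  have hE := nullMeasurableSet_upcrossingSet hT hg hh N n
  have hgap := ((hg.sub hh).indicator₀ hE).const_mul (N : ℝ)
  have hinvariant : ∫ ω, m (T ω) ∂μ = ∫ ω, m ω ∂μ := by
    conv_rhs => rw [← hT.map_eq]
    exact (integral_map hT.aemeasurable (by rw [hT.map_eq]; exact hm.1)).symm
  have hle := integral_mono (hm.add hgap) (hmT.add hg.pos_part)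
    (maxBirkhoffProfit_add_indicator_le hgh N n)
  simp only [Pi.add_apply] at hle
  rw [integral_add hm hgap, integral_add hmT hg.pos_part, hinvariant, integral_const_mul,
    integral_indicator₀ hE] at hle
  exact le_of_add_le_add_left hle

theorem mul_measureReal_upcrossingSet_le [IsFiniteMeasure μ] (hT : MeasurePreserving T μ μ)
    (hf : Integrable f μ) {α β : ℝ} (hαβ : α ≤ β) (N n : ℕ) :
    N * (β - α) * μ.real (upcrossingSet T (fun ω => f ω - α) (fun ω => f ω - β) N n) ≤
      ∫ ω, max (f ω - α) 0 ∂μ := by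
  have hle := mul_setIntegral_upcrossingSet_le (g := fun ω => f ω - α) (h := fun ω => f ω - β) hT
    (hf.sub (integrable_const α)) (hf.sub (integrable_const β))
    (fun ω => sub_le_sub_left hαβ (f ω)) N n
  simp only [Pi.sub_apply, sub_sub_sub_cancel_left, setIntegral_const, smul_eq_mul] at hle
  rwa [mul_assoc, mul_comm (β - α)]

theorem measure_iUnion_upcrossingSet_le [IsFiniteMeasure μ] (hT : MeasurePreserving T μ μ)
    (hf : Integrable f μ) {α β : ℝ} (hαβ : α < β) {N : ℕ} (hN : 0 < N) :
    μ (⋃ n, upcrossingSet T (fun ω => f ω - α) (fun ω => f ω - β) N n) ≤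
      ENNReal.ofReal ((∫ ω, max (f ω - α) 0 ∂μ) / (N * (β - α))) := by
  have hpos : 0 < (N : ℝ) * (β - α) := mul_pos (Nat.cast_pos.2 hN) (sub_pos.2 hαβ)
  refine le_of_tendsto' (tendsto_measure_iUnion_atTop (upcrossingSet_mono T _ _ N)) fun n => ?_
  rw [comp_apply, ← ofReal_measureReal]
  refine ENNReal.ofReal_le_ofReal ((le_div_iff₀' hpos).2 ?_)
  exact mul_measureReal_upcrossingSet_le hT hf hαβ.le N n

end UpcrossingInequality

section Oscillation

variable {X : Type*} {T : X → X} {f : X → ℝ} {α β : ℝ} {ω : X}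

theorem birkhoffAverage_lt_iff {n : ℕ} (hn : 0 < n) :
    birkhoffAverage ℝ T f n ω < α ↔ birkhoffSum T (fun ω => f ω - α) n ω < 0 := by
  have hn' : (0 : ℝ) < n := Nat.cast_pos.2 hn
  simp [birkhoffAverage, inv_mul_lt_iff₀ hn', birkhoffSum, Finset.sum_sub_distrib]

theorem lt_birkhoffAverage_iff {n : ℕ} (hn : 0 < n) :
    β < birkhoffAverage ℝ T f n ω ↔ 0 < birkhoffSum T (fun ω => f ω - β) n ω := by
  have hn' : (0 : ℝ) < n := Nat.cast_pos.2 hn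
  simp [birkhoffAverage, lt_inv_mul_iff₀ hn', birkhoffSum, Finset.sum_sub_distrib]

theorem abs_birkhoffAverage_le {C : ℝ} (hfC : ∀ ω, |f ω| ≤ C) (n : ℕ) (ω : X) :
    |birkhoffAverage ℝ T f n ω| ≤ C := by
  rcases Nat.eq_zero_or_pos n with rfl | hn
  · simpa using (abs_nonneg _).trans (hfC ω)
  · rw [birkhoffAverage, smul_eq_mul, abs_mul, abs_inv, Nat.abs_cast,
      inv_mul_le_iff₀ (Nat.cast_pos.2 hn)]
    exact (Finset.abs_sum_le_sum_abs _ _).trans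
      ((Finset.sum_le_card_nsmul _ _ C fun i _ => hfC _).trans (by simp))

theorem mem_iUnion_upcrossingSet_of_frequently
    (hα : ∃ᶠ n in atTop, birkhoffAverage ℝ T f n ω < α)
    (hβ : ∃ᶠ n in atTop, β < birkhoffAverage ℝ T f n ω) (N : ℕ) :
    ω ∈ ⋃ n, upcrossingSet T (fun ω => f ω - α) (fun ω => f ω - β) N n := by
  suffices h : ∀ k, ∃ n s, Schedule n k s ∧ s.length = N ∧
      ∀ p ∈ s, birkhoffSum T (fun ω => f ω - α) p.1 ω < 0 ∧
        0 < birkhoffSum T (fun ω => f ω - β) p.2 ω by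
    simpa [upcrossingSet] using h 0
  induction N with
  | zero => exact fun k => ⟨0, [], trivial, rfl, by simp⟩
  | succ N ih =>
    intro k
    obtain ⟨u, hu, hku⟩ := (hα.and_eventually (eventually_gt_atTop k)).exists
    obtain ⟨v, hv, huv⟩ := (hβ.and_eventually (eventually_gt_atTop u)).exists
    obtain ⟨n, s, hs, hN, hup⟩ := ih v
    refine ⟨max n v, (u, v) :: s,
      ⟨hku.le, huv, le_max_right _ _, hs.mono (le_max_left _ _)⟩, by simp [hN], ?_⟩
    rintro p (_ | ⟨_, hp⟩)
    · exact ⟨(birkhoffAverage_lt_iff (by lia)).1 hu, (lt_birkhoffAverage_iff (by lia)).1 hv⟩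
    · exact hup p hp

theorem exists_tendsto_birkhoffAverage {C : ℝ} (hfC : ∀ ω, |f ω| ≤ C)
    (h : ∀ α β : ℚ, α < β →
      ∃ N, ω ∉ ⋃ n, upcrossingSet T (fun ω => f ω - α) (fun ω => f ω - β) N n) :
    ∃ c, Tendsto (birkhoffAverage ℝ T f · ω) atTop (𝓝 c) := by
  refine tendsto_of_no_upcrossings Rat.denseRange_cast ?_
    (isBoundedUnder_of ⟨C, fun n => (abs_le.1 (abs_birkhoffAverage_le hfC n ω)).2⟩)
    (isBoundedUnder_of ⟨-C, fun n => (abs_le.1 (abs_birkhoffAverage_le hfC n ω)).1⟩)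
  rintro _ ⟨α, rfl⟩ _ ⟨β, rfl⟩ hαβ ⟨hα, hβ⟩
  obtain ⟨N, hN⟩ := h α β (Rat.cast_lt.1 hαβ)
  exact hN (mem_iUnion_upcrossingSet_of_frequently hα hβ N)

variable [MeasurableSpace X] {μ : Measure X} [IsFiniteMeasure μ]

theorem measure_iInter_iUnion_upcrossingSet (hT : MeasurePreserving T μ μ) (hf : Integrable f μ)
    (hαβ : α < β) :
    μ (⋂ N, ⋃ n, upcrossingSet T (fun ω => f ω - α) (fun ω => f ω - β) N n) = 0 := by
  have hlim : Tendsto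
      (fun N : ℕ => ENNReal.ofReal ((∫ ω, max (f ω - α) 0 ∂μ) / (N * (β - α)))) atTop (𝓝 0) := by
    rw [← ENNReal.ofReal_zero]
    exact ENNReal.tendsto_ofReal (tendsto_const_nhds.div_atTop
      (tendsto_natCast_atTop_atTop.atTop_mul_const (sub_pos.2 hαβ)))
  refine le_antisymm (ge_of_tendsto hlim ?_) zero_le
  filter_upwards [eventually_gt_atTop 0] with N hN
  exact (measure_mono (iInter_subset _ N)).trans (measure_iUnion_upcrossingSet_le hT hf hαβ hN)

theorem ae_exists_tendsto_birkhoffAverage (hT : MeasurePreserving T μ μ) (hf : Integrable f μ)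
    {C : ℝ} (hfC : ∀ ω, |f ω| ≤ C) :
    ∀ᵐ ω ∂μ, ∃ c, Tendsto (birkhoffAverage ℝ T f · ω) atTop (𝓝 c) := by
  have hfew : ∀ᵐ ω ∂μ, ∀ α β : ℚ, α < β →
      ∃ N, ω ∉ ⋃ n, upcrossingSet T (fun ω => f ω - α) (fun ω => f ω - β) N n := by
    simp only [ae_all_iff]
    intro α β hαβ
    simpa only [mem_iInter, not_forall] using measure_eq_zero_iff_ae_notMem.1
      (measure_iInter_iUnion_upcrossingSet hT hf (Rat.cast_lt (K := ℝ).2 hαβ))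
  exact hfew.mono fun ω hω => exists_tendsto_birkhoffAverage hfC hω

end Oscillation

section RandomPoints

theorem schedule_iff_forall_lt {n k : ℕ} {s : List (ℕ × ℕ)} :
    Schedule n k s ↔ ∀ i < s.length, (((0, k) :: s).getD i (0, 0)).2 ≤ (s.getD i (0, 0)).1 ∧
      (s.getD i (0, 0)).1 < (s.getD i (0, 0)).2 ∧ (s.getD i (0, 0)).2 ≤ n := by
  induction s generalizing k with
  | nil => simp [Schedule]
  | cons p s ih =>
    have hshift : ∀ i, (((0, p.2) :: s).getD i (0, 0)).2 = ((p :: s).getD i (0, 0)).2 := by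
      rintro (_ | i) <;> simp
    rw [List.length_cons, Nat.forall_lt_succ_left', Schedule, ih]
    simp only [hshift, List.getD_cons_zero, List.getD_cons_succ, and_assoc]

theorem rePred_schedule : REPred fun q : ℕ × List (ℕ × ℕ) => Schedule q.1 0 q.2 := by
  have hget : Primrec₂ fun (l : List (ℕ × ℕ)) i => l.getD i (0, 0) := Primrec.list_getD (0, 0)
  have hcur : Primrec fun z : (ℕ × List (ℕ × ℕ)) × ℕ => z.1.2.getD z.2 (0, 0) :=
    hget.comp (Primrec.snd.comp .fst) .snd
  have hprev : Primrec fun z : (ℕ × List (ℕ × ℕ)) × ℕ => ((0, 0) :: z.1.2).getD z.2 (0, 0) :=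
    hget.comp (Primrec.list_cons.comp (.const _) (Primrec.snd.comp .fst)) .snd
  have hstep : REPred fun z : (ℕ × List (ℕ × ℕ)) × ℕ =>
      (((0, 0) :: z.1.2).getD z.2 (0, 0)).2 ≤ (z.1.2.getD z.2 (0, 0)).1 ∧
      (z.1.2.getD z.2 (0, 0)).1 < (z.1.2.getD z.2 (0, 0)).2 ∧
      (z.1.2.getD z.2 (0, 0)).2 ≤ z.1.1 :=
    rePred_of_primrecPred ((Primrec.nat_le.comp (Primrec.snd.comp hprev)
      (Primrec.fst.comp hcur)).and ((Primrec.nat_lt.comp (Primrec.fst.comp hcur)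
        (Primrec.snd.comp hcur)).and (Primrec.nat_le.comp (Primrec.snd.comp hcur)
          (Primrec.fst.comp .fst))))
  exact (rePred_comp (rePred_forall_lt hstep) (g := fun q : ℕ × List (ℕ × ℕ) => (q, q.2.length))
    (Primrec.id.pair (Primrec.list_length.comp .snd)).to_comp).of_eq
      fun q => (schedule_iff_forall_lt (n := q.1) (k := 0) (s := q.2)).symm

theorem EffectivelyUpperSemicontinuous.effectivelyOpen_birkhoffSum_neg {g : Cantor → ℝ}
    (hg : EffectivelyUpperSemicontinuous g) {T : Cantor → Cantor}
    (hT : ComputableTransformation T) :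
    EffectivelyOpen fun n => {ω | _root_.birkhoffSum T g n ω < 0} :=
  ((hg.birkhoffSum hT).comp (g := fun n => (n, ((0, 0), 0)))
    (Computable.id.pair (.const _))).of_eq fun n => by simp [RatCode.val]

theorem effectivelyOpen_iUnion_upcrossingSet {g h : Cantor → ℝ} {T : Cantor → Cantor}
    (hg : EffectivelyUpperSemicontinuous g) (hh : EffectivelyUpperSemicontinuous (-h))
    (hT : ComputableTransformation T) :
    EffectivelyOpen fun N => ⋃ n, upcrossingSet T g h N n := by
  have hbuy := hg.effectivelyOpen_birkhoffSum_neg hT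
  have hsell := hh.effectivelyOpen_birkhoffSum_neg hT
  simp only [birkhoffSum_neg, Left.neg_neg_iff] at hsell
  have htrade : EffectivelyOpen fun q : Unit × (ℕ × ℕ) =>
      {ω | birkhoffSum T g q.2.1 ω < 0} ∩ {ω | 0 < birkhoffSum T h q.2.2 ω} :=
    (hbuy.comp (Computable.fst.comp .snd)).inter (hsell.comp (Computable.snd.comp .snd))
  have htrades : EffectivelyOpen fun z : ℕ × (ℕ × List (ℕ × ℕ)) => ⋂ p ∈ z.2.2,
      {ω | birkhoffSum T g p.1 ω < 0} ∩ {ω | 0 < birkhoffSum T h p.2 ω} :=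
    htrade.iInter_mem_list.comp (g := fun z : ℕ × (ℕ × List (ℕ × ℕ)) => ((), z.2.2))
      ((Computable.const ()).pair (Computable.snd.comp .snd))
  have hschedule : EffectivelyOpen fun z : ℕ × (ℕ × List (ℕ × ℕ)) =>
      {_ω | Schedule z.2.1 0 z.2.2 ∧ z.2.2.length = z.1} :=
    .of_rePred (rePred_and (rePred_comp rePred_schedule .snd) (rePred_of_primrecPred
      (Primrec.eq.comp (Primrec.list_length.comp (Primrec.snd.comp .snd)) .fst)))
  refine (hschedule.inter htrades).iUnion.of_eq fun N => ?_
  ext ω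
  simp [upcrossingSet, and_assoc]

theorem ComputableFun.exists_abs_le {f : Cantor → ℝ} (hf : ComputableFun f) :
    ∃ C, ∀ ω, |f ω| ≤ C := by
  obtain ⟨C, hC⟩ := isCompact_univ.exists_bound_of_continuousOn hf.continuous.continuousOn
  exact ⟨C, fun ω => hC ω (mem_univ ω)⟩

theorem ComputableFun.integrable {f : Cantor → ℝ} (hf : ComputableFun f) (P : Measure Cantor)
    [IsFiniteMeasure P] : Integrable f P := by
  obtain ⟨C, hC⟩ := hf.exists_abs_le
  exact .of_bound hf.continuous.aestronglyMeasurable C (.of_forall hC)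

theorem ComputableFun.effectivelyUpperSemicontinuous_neg_sub_const {f : Cantor → ℝ}
    (hf : ComputableFun f) (r : ℚ) : EffectivelyUpperSemicontinuous (-fun ω => f ω - r) := by
  convert hf.neg.2.effectivelyUpperSemicontinuous.sub_const (-r) using 2 with ω
  simp only [Pi.neg_apply, Rat.cast_neg]
  ring

theorem IsMartinLofRandom.exists_notMem_iUnion_upcrossingSet {P : Measure Cantor}
    [IsFiniteMeasure P] {f : Cantor → ℝ} (hf : ComputableFun f) {T : Cantor → Cantor}
    (hT : ComputableTransformation T) (hTP : MeasurePreserving T P P) {α β : ℚ} (hαβ : α < β)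
    {ω : Cantor} (hω : IsMartinLofRandom P ω) :
    ∃ N, ω ∉ ⋃ n, upcrossingSet T (fun ω => f ω - α) (fun ω => f ω - β) N n := by
  have hgap : (0 : ℝ) < β - α := sub_pos.2 (Rat.cast_lt.2 hαβ)
  obtain ⟨K, hK⟩ := exists_nat_ge ((∫ ω, max (f ω - α) 0 ∂P) / (β - α))
  have hopen := effectivelyOpen_iUnion_upcrossingSet
    (hf.2.effectivelyUpperSemicontinuous.sub_const α)
    (hf.effectivelyUpperSemicontinuous_neg_sub_const β) hT
  have hmeasure : ∀ k, P (⋃ n, upcrossingSet T (fun ω => f ω - α) (fun ω => f ω - β)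
      ((K + 1) * 2 ^ k) n) ≤ (2⁻¹ : ENNReal) ^ k := by
    intro k
    refine (measure_iUnion_upcrossingSet_le hTP (hf.integrable P) (Rat.cast_lt.2 hαβ)
      (by positivity)).trans ?_
    rw [← ENNReal.ofReal_ofNat, ← ENNReal.ofReal_inv_of_pos two_pos, ← ENNReal.ofReal_pow (by simp)]
    refine ENNReal.ofReal_le_ofReal ((div_le_iff₀ (by positivity)).2 ?_)
    calc ∫ ω, max (f ω - α) 0 ∂P ≤ (K + 1) * (β - α) := by
          rw [div_le_iff₀ hgap] at hK
          linarith
      _ = 2⁻¹ ^ k * (((K + 1) * 2 ^ k : ℕ) * (β - α)) := by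
          rw [inv_pow]
          push_cast
          field_simp
  obtain ⟨k, hk⟩ := hω.exists_notMem (hopen.comp (g := fun k => (K + 1) * 2 ^ k)
    (Primrec.nat_mul.comp (.const (K + 1)) primrec_two_pow).to_comp) hmeasure
  exact ⟨_, hk⟩

theorem IsMartinLofRandom.exists_tendsto_birkhoffAverage {P : Measure Cantor}
    [IsFiniteMeasure P] {f : Cantor → ℝ} (hf : ComputableFun f) {T : Cantor → Cantor}
    (hT : ComputableTransformation T) (hTP : MeasurePreserving T P P) {ω : Cantor}
    (hω : IsMartinLofRandom P ω) : ∃ c, Tendsto (birkhoffAverage ℝ T f · ω) atTop (𝓝 c) :=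
  have ⟨_, hC⟩ := hf.exists_abs_le
  AlgorithmicErgodic.exists_tendsto_birkhoffAverage hC
    fun _ _ hαβ => hω.exists_notMem_iUnion_upcrossingSet hf hT hTP hαβ

end RandomPoints

section MeasuresOfEffectivelyOpenSets

theorem disjoint_cylinder {x y : List Bool} (hlen : x.length = y.length) (hxy : x ≠ y) :
    Disjoint (cylinder x) (cylinder y) := by
  refine disjoint_left.2 fun ω hx hy => hxy ?_
  rw [isPrefix_iff_eq_initSeg.1 hx, isPrefix_iff_eq_initSeg.1 hy, hlen]

variable {P : Measure Cantor} {L : ℕ} {l : List (List Bool × RatCode)} {S : Set (List Bool)}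

theorem measureReal_biUnion_cylinder (P : Measure Cantor) [IsFiniteMeasure P]
    {F : Finset (List Bool)} (hF : ∀ x ∈ F, x.length = L) :
    P.real (⋃ x ∈ F, cylinder x) = ∑ x ∈ F, P.real (cylinder x) :=
  measureReal_biUnion_finset
    (fun x hx y hy hxy => disjoint_cylinder ((hF x hx).trans (hF y hy).symm) hxy)
    (fun x _ => (isOpen_cylinder x).measurableSet)

/-- A finite witness for a lower bound on the measure of `⋃ x ∈ S, Γ_x`: distinct strings in `S`
of the same length `L`, each with a rational number below the measure of its interval. -/
def MeasureWitness (P : Measure Cantor) (S : Set (List Bool)) (L : ℕ)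
    (l : List (List Bool × RatCode)) : Prop :=
  (∀ p ∈ l, (p.1.length = L ∧ p.1 ∈ S) ∧ p.2.val < P.real (cylinder p.1)) ∧ (l.map Prod.fst).Nodup

theorem MeasureWitness.val_sum_le [IsFiniteMeasure P] (h : MeasureWitness P S L l) :
    ((RatCode.sum (l.map Prod.snd)).val : ℝ) ≤ P.real (⋃ x ∈ S, cylinder x) := by
  have hmem : ∀ x ∈ (l.map Prod.fst).toFinset, x.length = L ∧ x ∈ S := by
    intro x hx
    obtain ⟨p, hp, rfl⟩ := List.mem_map.1 (List.mem_toFinset.1 hx)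
    exact (h.1 p hp).1
  calc ((RatCode.sum (l.map Prod.snd)).val : ℝ)
      = (l.map fun p => (p.2.val : ℝ)).sum := by
        rw [RatCode.val_sum, Rat.cast_list_sum, List.map_map, List.map_map]; rfl
    _ ≤ (l.map fun p => P.real (cylinder p.1)).sum :=
        List.sum_le_sum fun p hp => (h.1 p hp).2.le
    _ = P.real (⋃ x ∈ (l.map Prod.fst).toFinset, cylinder x) := by
        rw [measureReal_biUnion_cylinder P fun x hx => (hmem x hx).1, List.sum_toFinset _ h.2,
          List.map_map]
        rfl
    _ ≤ P.real (⋃ x ∈ S, cylinder x) :=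
        measureReal_mono (biUnion_subset_biUnion_left fun x hx => (hmem x hx).2)
          (measure_ne_top P _)

theorem tendsto_measureReal_biUnion_cylinder [IsFiniteMeasure P]
    (hS : ∀ x y, x <+: y → x ∈ S → y ∈ S) :
    Tendsto (fun L => P.real (⋃ x ∈ {x | x.length = L ∧ x ∈ S}, cylinder x)) atTop
      (𝓝 (P.real (⋃ x ∈ S, cylinder x))) := by
  have hmono : Monotone fun L => ⋃ x ∈ {x | x.length = L ∧ x ∈ S}, cylinder x := by
    intro L M hLM ω hω
    obtain ⟨x, ⟨rfl, hxS⟩, hxω⟩ := mem_iUnion₂.1 hω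
    have hxω : IsPrefix x ω := hxω
    exact mem_biUnion (x := initSeg ω M) ⟨by simp, hS _ _ (hxω.prefix_initSeg hLM) hxS⟩
      (isPrefix_initSeg ω M)
  have hunion : ⋃ x ∈ S, cylinder x = ⋃ L, ⋃ x ∈ {x | x.length = L ∧ x ∈ S}, cylinder x := by
    ext ω
    simp
  rw [hunion]
  exact (ENNReal.tendsto_toReal (measure_ne_top P _)).comp (tendsto_measure_iUnion_atTop hmono)

theorem exists_measureWitness [IsFiniteMeasure P] (hS : ∀ x y, x <+: y → x ∈ S → y ∈ S) {b : ℝ}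
    (hb : b < P.real (⋃ x ∈ S, cylinder x)) :
    ∃ L l, MeasureWitness P S L l ∧ b < (RatCode.sum (l.map Prod.snd)).val := by
  obtain ⟨L, hL⟩ :=
    ((tendsto_measureReal_biUnion_cylinder hS).eventually (lt_mem_nhds hb)).exists
  obtain ⟨F, hF⟩ := ((List.finite_length_eq Bool L).inter_of_left S).exists_finset
  have hF' : ∀ x, x ∈ F ↔ x.length = L ∧ x ∈ S := hF
  simp only [mem_ofPred_eq, ← hF'] at hL
  rw [measureReal_biUnion_cylinder P fun x hx => ((hF' x).1 hx).1] at hL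
  obtain ⟨c, hc, hbc⟩ := RatCode.exists_val_lt_and_lt_sum F _ hL
  refine ⟨L, F.toList.map fun x => (x, c x), ⟨fun p hp => ?_, ?_⟩, ?_⟩
  · obtain ⟨x, hx, rfl⟩ := List.mem_map.1 hp
    exact ⟨(hF' x).1 (Finset.mem_toList.1 hx), hc x⟩
  · simpa [comp_def] using F.nodup_toList
  · rw [RatCode.val_sum, Rat.cast_list_sum]
    simpa [comp_def] using hbc

theorem rePred_nodup {A : Type*} [Primcodable A] : REPred fun l : List A => l.Nodup := by
  have hne : REPred fun z : (List A × ℕ) × ℕ => z.1.1[z.2]? ≠ z.1.1[z.1.2]? :=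
    rePred_of_primrecPred (Primrec.eq.comp
      (Primrec.list_getElem?.comp (Primrec.fst.comp .fst) .snd)
      (Primrec.list_getElem?.comp (Primrec.fst.comp .fst) (Primrec.snd.comp .fst))).not
  have hne_before : REPred fun z : List A × ℕ => ∀ i < z.2, z.1[i]? ≠ z.1[z.2]? :=
    rePred_comp (rePred_forall_lt hne) (g := fun z : List A × ℕ => (z, z.2))
      (Computable.id.pair .snd)
  refine (rePred_comp (rePred_forall_lt hne_before) (g := fun l : List A => (l, l.length))
    (Computable.id.pair Computable.list_length)).of_eq fun l => ?_
  rw [List.nodup_iff_getElem?_ne_getElem?]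
  exact ⟨fun h i j hij hj => h j hj i hij, fun h j hj i hij => h i j hij hj⟩

theorem LowerSemicomputable.rePred_val_lt {A : Type} [Primcodable A] {g : A → ℝ}
    (hg : LowerSemicomputable g) : REPred fun p : A × RatCode => p.2.val < g p.1 := by
  obtain ⟨h, hh, hmono, hlim⟩ := hg
  have hlt : REPred fun q : (A × RatCode) × ℕ => q.1.2.val < (h q.2 q.1.1).val :=
    rePred_comp (rePred_of_primrecPred RatCode.primrecRel_val_lt)
      (g := fun q : (A × RatCode) × ℕ => (q.1.2, h q.2 q.1.1))
      ((Computable.snd.comp .fst).pair (hh.comp .snd (Computable.fst.comp .fst)))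
  refine (rePred_exists hlt).of_eq fun p => ⟨fun ⟨m, hm⟩ => ?_, fun hp => ?_⟩
  · have hmono' : Monotone fun n => ((h n p.1).val : ℝ) :=
      monotone_nat_of_le_succ fun n => Rat.cast_le.2 (hmono n p.1)
    exact (Rat.cast_lt.2 hm).trans_le (hmono'.ge_of_tendsto (hlim p.1) m)
  · obtain ⟨m, hm⟩ := ((hlim p.1).eventually (lt_mem_nhds hp)).exists
    exact ⟨m, Rat.cast_lt.1 hm⟩

theorem LowerSemicomputable.rePred_measureWitness
    (hP : LowerSemicomputable fun x => P.real (cylinder x)) {A : Type*} [Primcodable A]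
    {S : A × List Bool → Prop} (hS : REPred S) :
    REPred fun q : (A × ℕ) × List (List Bool × RatCode) =>
      MeasureWitness P {x | S (q.1.1, x)} q.1.2 q.2 := by
  have hentry : REPred fun z : (A × ℕ) × (List Bool × RatCode) =>
      (z.2.1.length = z.1.2 ∧ S (z.1.1, z.2.1)) ∧ z.2.2.val < P.real (cylinder z.2.1) :=
    rePred_and (rePred_and
      (rePred_of_primrecPred (Primrec.eq.comp
        (Primrec.list_length.comp (Primrec.fst.comp .snd)) (Primrec.snd.comp .fst)))
      (rePred_comp hS ((Computable.fst.comp .fst).pair (Computable.fst.comp .snd))))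
      (rePred_comp hP.rePred_val_lt .snd)
  exact rePred_and (rePred_forall_mem_list hentry)
    (rePred_comp rePred_nodup (Primrec.list_map .snd (Primrec.fst.comp₂ Primrec₂.right)).to_comp)

theorem EffectivelyOpen.rePred_lt_measureReal [IsFiniteMeasure P] {A : Type*} [Primcodable A]
    {U : A → Set Cantor} (hU : EffectivelyOpen U)
    (hP : LowerSemicomputable fun x => P.real (cylinder x)) :
    REPred fun p : A × RatCode => p.2.val < P.real (U p.1) := by
  obtain ⟨S, hS, hSmono, hUS⟩ := hU.exists_monotone
  have hUS' : ∀ a, U a = ⋃ x ∈ {x | S (a, x)}, cylinder x := by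
    intro a
    ext ω
    simp [hUS, cylinder, and_comm]
  have hsum : REPred fun q : (A × RatCode) × (ℕ × List (List Bool × RatCode)) =>
      q.1.2.val < (RatCode.sum (q.2.2.map Prod.snd)).val :=
    rePred_of_primrecPred (RatCode.primrecRel_val_lt.comp (Primrec.snd.comp .fst)
      (RatCode.primrec_sum.comp
        (Primrec.list_map (Primrec.snd.comp .snd) (Primrec.snd.comp₂ Primrec₂.right))))
  have hwitness := rePred_and (rePred_comp (hP.rePred_measureWitness hS)
    (g := fun q : (A × RatCode) × (ℕ × List (List Bool × RatCode)) => ((q.1.1, q.2.1), q.2.2))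
      (((Computable.fst.comp .fst).pair (Computable.fst.comp .snd)).pair
        (Computable.snd.comp .snd))) hsum
  refine (rePred_exists hwitness).of_eq fun p => ?_
  rw [hUS']
  constructor
  · rintro ⟨⟨L, l⟩, hl, hlt⟩
    exact (Rat.cast_lt.2 hlt).trans_le hl.val_sum_le
  · intro hlt
    obtain ⟨L, l, hl, hsum⟩ := exists_measureWitness (hSmono p.1) hlt
    exact ⟨(L, l), hl, Rat.cast_lt.1 hsum⟩

end MeasuresOfEffectivelyOpenSets

section EffectiveBorelCantelli

variable {P : Measure Cantor} {U V : ℕ → Set Cantor} {ω : Cantor}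

theorem IsMartinLofRandom.eventually_notMem (hω : IsMartinLofRandom P ω) (hV : EffectivelyOpen V)
    (hPV : ∀ k, P (V k) ≤ (2⁻¹ : ENNReal) ^ k) : ∀ᶠ k in atTop, ω ∉ V k := by
  have hopen : EffectivelyOpen fun k => ⋃ j, V (k + 1 + j) :=
    (hV.comp (g := fun p : ℕ × ℕ => p.1 + 1 + p.2)
      (Primrec.nat_add.comp (Primrec.succ.comp .fst) .snd).to_comp).iUnion
  have hmeasure : ∀ k, P (⋃ j, V (k + 1 + j)) ≤ (2⁻¹ : ENNReal) ^ k := by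
    intro k
    calc P (⋃ j, V (k + 1 + j)) ≤ ∑' j, P (V (k + 1 + j)) := measure_iUnion_le _
      _ ≤ ∑' j, (2⁻¹ : ENNReal) ^ (k + 1 + j) := ENNReal.tsum_le_tsum fun j => hPV _
      _ = 2⁻¹ ^ k := by
        simp only [pow_add, ENNReal.tsum_mul_left, ENNReal.tsum_geometric, pow_one,
          ENNReal.one_sub_inv_two, inv_inv]
        rw [mul_assoc, ENNReal.inv_mul_cancel two_ne_zero ENNReal.ofNat_ne_top, mul_one]
  obtain ⟨k, hk⟩ := hω.exists_notMem hopen hmeasure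
  filter_upwards [eventually_ge_atTop (k + 1)] with n hn hVn
  exact hk (mem_iUnion.2 ⟨n - (k + 1), by rwa [Nat.add_sub_cancel' hn]⟩)

theorem RatCode.exists_primrec_val_eq_one_sub_pow :
    ∃ r : ℕ → RatCode, Primrec r ∧ ∀ k, ((r k).val : ℝ) = 1 - 2⁻¹ ^ k := by
  refine ⟨fun k => ((2 ^ k, 1), 2 ^ k - 1), (primrec_two_pow.pair (.const 1)).pair
    (Primrec.nat_sub.comp primrec_two_pow (.const 1)), fun k => ?_⟩
  simp only [RatCode.val, Nat.cast_sub Nat.one_le_two_pow]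
  push_cast
  rw [sub_add_cancel, inv_pow]
  field_simp

theorem EffectivelyOpen.exists_computable_one_sub_lt_measureReal [IsFiniteMeasure P]
    (hU : EffectivelyOpen U) (hP : LowerSemicomputable fun x => P.real (cylinder x))
    (hlim : Tendsto (fun n => P.real (U n)) atTop (𝓝 1)) :
    ∃ g : ℕ → ℕ, Computable g ∧ ∀ k, k ≤ g k ∧ 1 - 2⁻¹ ^ k < P.real (U (g k)) := by
  obtain ⟨r, hr, hval⟩ := RatCode.exists_primrec_val_eq_one_sub_pow
  have hle : REPred fun p : ℕ × ℕ => p.1 ≤ p.2 :=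
    rePred_of_primrecPred (Primrec.nat_le.comp .fst .snd)
  have hlt : REPred fun p : ℕ × ℕ => (r p.1).val < P.real (U p.2) :=
    rePred_comp (hU.rePred_lt_measureReal hP) (g := fun p : ℕ × ℕ => (p.2, r p.1))
      (Computable.snd.pair (hr.to_comp.comp .fst))
  have hex : ∀ k, ∃ n, k ≤ n ∧ (r k).val < P.real (U n) := fun k =>
    ((eventually_ge_atTop k).and (hlim.eventually (lt_mem_nhds (by simp [hval])))).exists
  simpa only [hval] using exists_computable_choice_of_rePred (rePred_and hle hlt) hex

theorem IsMartinLofRandom.frequently_notMem [IsProbabilityMeasure P] (hω : IsMartinLofRandom P ω)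
    (hP : LowerSemicomputable fun x => P.real (cylinder x)) (hU : EffectivelyOpen U)
    (hV : EffectivelyOpen V) (hUV : ∀ n, Disjoint (U n) (V n))
    (hae : ∀ᵐ ω ∂P, ∀ᶠ n in atTop, ω ∈ U n) : ∃ᶠ n in atTop, ω ∉ V n := by
  have hlim : Tendsto (fun n => P (U n)) atTop (𝓝 (P univ)) :=
    tendsto_measure_of_ae_tendsto_indicator_of_isFiniteMeasure atTop .univ
      (fun n => (hU.isOpen n).measurableSet) (by simpa using hae)
  rw [measure_univ] at hlim
  obtain ⟨g, hg, hgU⟩ := hU.exists_computable_one_sub_lt_measureReal hP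
    ((ENNReal.tendsto_toReal ENNReal.one_ne_top).comp hlim)
  have hmeasure : ∀ k, P (V (g k)) ≤ (2⁻¹ : ENNReal) ^ k := by
    intro k
    have hsum : P.real (U (g k)) + P.real (V (g k)) ≤ 1 := by
      rw [← measureReal_union (hUV _) (hV.isOpen _).measurableSet]
      exact measureReal_le_one
    rw [← ofReal_measureReal, ← ENNReal.ofReal_ofNat, ← ENNReal.ofReal_inv_of_pos two_pos,
      ← ENNReal.ofReal_pow (by simp)]
    exact ENNReal.ofReal_le_ofReal (by linarith [(hgU k).2])
  exact (tendsto_atTop_mono (fun k => (hgU k).1) tendsto_id).frequently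
    (hω.eventually_notMem (hV.comp hg) hmeasure).frequently

end EffectiveBorelCantelli

section BirkhoffLimit

variable {X : Type*} {T : X → X} {f : X → ℝ} {C : ℝ} {ω : X}

/-- The limit of the Birkhoff averages of `f` along the orbit of `ω`. Where the averages diverge,
`limUnder` is a real number not depending on `ω`, so that `birkhoffLimit T f` is invariant at every
point and not only almost everywhere. -/
noncomputable def birkhoffLimit (T : X → X) (f : X → ℝ) (ω : X) : ℝ :=
  limUnder atTop (birkhoffAverage ℝ T f · ω)

theorem tendsto_birkhoffLimit (h : ∃ c, Tendsto (birkhoffAverage ℝ T f · ω) atTop (𝓝 c)) :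
    Tendsto (birkhoffAverage ℝ T f · ω) atTop (𝓝 (birkhoffLimit T f ω)) :=
  tendsto_nhds_limUnder h

theorem birkhoffLimit_apply (hfC : ∀ ω, |f ω| ≤ C) (ω : X) :
    birkhoffLimit T f (T ω) = birkhoffLimit T f ω := by
  have hbounded : Bornology.IsBounded (range f) :=
    isBounded_iff_forall_norm_le.2 ⟨C, forall_mem_range.2 hfC⟩
  have hdiff := tendsto_birkhoffAverage_apply_sub_birkhoffAverage' ℝ hbounded T ω
  have hiff : ∀ c, Tendsto (birkhoffAverage ℝ T f · (T ω)) atTop (𝓝 c) ↔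
      Tendsto (birkhoffAverage ℝ T f · ω) atTop (𝓝 c) := fun c =>
    ⟨fun h => by simpa using h.sub hdiff, fun h => by simpa using h.add hdiff⟩
  exact congrArg Classical.epsilon (funext fun c => propext (hiff c))

variable [MeasurableSpace X] {μ : Measure X}

theorem integrable_birkhoffAverage (hT : MeasurePreserving T μ μ) (hf : Integrable f μ) (n : ℕ) :
    Integrable (birkhoffAverage ℝ T f n) μ :=
  (integrable_birkhoffSum hT hf n).smul (n : ℝ)⁻¹

theorem integral_birkhoffAverage (hT : MeasurePreserving T μ μ) (hf : Integrable f μ) {n : ℕ}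
    (hn : 0 < n) : ∫ ω, birkhoffAverage ℝ T f n ω ∂μ = ∫ ω, f ω ∂μ := by
  have hiterate : ∀ i, ∫ ω, f (T^[i] ω) ∂μ = ∫ ω, f ω ∂μ := by
    intro i
    have hi := hT.iterate i
    rw [← integral_map hi.measurable.aemeasurable (by rw [hi.map_eq]; exact hf.1), hi.map_eq]
  have hn' : (n : ℝ) ≠ 0 := Nat.cast_ne_zero.2 hn.ne'
  have hint : ∀ i ∈ Finset.range n, Integrable (fun ω => f (T^[i] ω)) μ := fun i _ =>
    (hT.iterate i).integrable_comp_of_integrable hf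
  simp only [birkhoffAverage, birkhoffSum, smul_eq_mul]
  rw [integral_const_mul, integral_finsetSum _ hint]
  simp [hiterate, hn']

variable [IsFiniteMeasure μ]

theorem ae_tendsto_birkhoffLimit (hT : MeasurePreserving T μ μ) (hf : Integrable f μ)
    (hfC : ∀ ω, |f ω| ≤ C) :
    ∀ᵐ ω ∂μ, Tendsto (birkhoffAverage ℝ T f · ω) atTop (𝓝 (birkhoffLimit T f ω)) :=
  (ae_exists_tendsto_birkhoffAverage hT hf hfC).mono fun _ => tendsto_birkhoffLimit

theorem integrable_birkhoffLimit (hT : MeasurePreserving T μ μ) (hf : Integrable f μ)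
    (hfC : ∀ ω, |f ω| ≤ C) : Integrable (birkhoffLimit T f) μ := by
  have hlim := ae_tendsto_birkhoffLimit hT hf hfC
  refine .of_bound (aestronglyMeasurable_of_tendsto_ae atTop
    (fun n => (integrable_birkhoffAverage hT hf n).1) hlim) C (hlim.mono fun ω hω => ?_)
  exact le_of_tendsto' hω.norm fun n => abs_birkhoffAverage_le hfC n ω

theorem integral_birkhoffLimit (hT : MeasurePreserving T μ μ) (hf : Integrable f μ)
    (hfC : ∀ ω, |f ω| ≤ C) : ∫ ω, birkhoffLimit T f ω ∂μ = ∫ ω, f ω ∂μ := by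
  have hlim := tendsto_integral_of_dominated_convergence (fun _ => C)
    (fun n => (integrable_birkhoffAverage hT hf n).1) (integrable_const C)
    (fun n => .of_forall (abs_birkhoffAverage_le hfC n)) (ae_tendsto_birkhoffLimit hT hf hfC)
  refine tendsto_nhds_unique hlim (tendsto_const_nhds.congr' ?_)
  filter_upwards [eventually_gt_atTop 0] with n hn
  exact (integral_birkhoffAverage hT hf hn).symm

theorem ae_tendsto_birkhoffAverage_integral {μ : Measure X} [IsProbabilityMeasure μ]
    (hT : Ergodic T μ) (hf : Integrable f μ) (hfC : ∀ ω, |f ω| ≤ C) :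
    ∀ᵐ ω ∂μ, Tendsto (birkhoffAverage ℝ T f · ω) atTop (𝓝 (∫ α, f α ∂μ)) := by
  obtain ⟨c, hc⟩ := hT.ae_eq_const_of_ae_eq_comp_ae
    (integrable_birkhoffLimit hT.toMeasurePreserving hf hfC).1
    (.of_forall fun ω => birkhoffLimit_apply hfC ω)
  have hcf : c = ∫ α, f α ∂μ := by
    rw [← integral_birkhoffLimit hT.toMeasurePreserving hf hfC, integral_congr_ae hc]
    simp
  filter_upwards [hc, ae_tendsto_birkhoffLimit hT.toMeasurePreserving hf hfC] with ω hωc hω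
  rwa [hωc, const_apply, hcf] at hω

end BirkhoffLimit

section ErgodicTheorem

variable {P : Measure Cantor} {f : Cantor → ℝ} {T : Cantor → Cantor} {ω : Cantor} {c : ℝ}

theorem IsMartinLofRandom.le_integral_of_tendsto_birkhoffAverage [IsProbabilityMeasure P]
    (hω : IsMartinLofRandom P ω) (hP : LowerSemicomputable fun x => P.real (cylinder x))
    (hf : ComputableFun f) (hT : ComputableTransformation T) (hTP : Ergodic T P)
    (hc : Tendsto (birkhoffAverage ℝ T f · ω) atTop (𝓝 c)) : c ≤ ∫ α, f α ∂P := by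
  by_contra! hlt
  obtain ⟨r, hfr, hrc⟩ := exists_rat_btwn hlt
  obtain ⟨C, hfC⟩ := hf.exists_abs_le
  have hbelow :=
    (hf.2.effectivelyUpperSemicontinuous.sub_const r).effectivelyOpen_birkhoffSum_neg hT
  have habove := (hf.effectivelyUpperSemicontinuous_neg_sub_const r).effectivelyOpen_birkhoffSum_neg
    hT
  simp only [birkhoffSum_neg, Left.neg_neg_iff] at habove
  have hdisjoint : ∀ n, Disjoint {ω | birkhoffSum T (fun ω => f ω - r) n ω < 0}
      {ω | 0 < birkhoffSum T (fun ω => f ω - r) n ω} := by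
    simp only [disjoint_left, mem_ofPred_eq]
    exact fun _ _ => lt_asymm
  have hae : ∀ᵐ ω ∂P, ∀ᶠ n in atTop, birkhoffSum T (fun ω => f ω - r) n ω < 0 := by
    filter_upwards [ae_tendsto_birkhoffAverage_integral hTP (hf.integrable P) hfC] with ω hlim
    filter_upwards [hlim.eventually (gt_mem_nhds hfr), eventually_gt_atTop 0] with n hn hn0
    exact (birkhoffAverage_lt_iff hn0).1 hn
  have hlarge : ∀ᶠ n in atTop, 0 < birkhoffSum T (fun ω => f ω - r) n ω := by
    filter_upwards [hc.eventually (lt_mem_nhds hrc), eventually_gt_atTop 0] with n hn hn0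
    exact (lt_birkhoffAverage_iff hn0).1 hn
  exact hω.frequently_notMem hP hbelow habove hdisjoint hae
    (hlarge.mono fun n hn hmem => hmem hn)

theorem IsMartinLofRandom.eq_integral_of_tendsto_birkhoffAverage [IsProbabilityMeasure P]
    (hω : IsMartinLofRandom P ω) (hP : LowerSemicomputable fun x => P.real (cylinder x))
    (hf : ComputableFun f) (hT : ComputableTransformation T) (hTP : Ergodic T P)
    (hc : Tendsto (birkhoffAverage ℝ T f · ω) atTop (𝓝 c)) : c = ∫ α, f α ∂P := by
  refine (hω.le_integral_of_tendsto_birkhoffAverage hP hf hT hTP hc).antisymm ?_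
  have hneg : Tendsto (birkhoffAverage ℝ T (-f) · ω) atTop (𝓝 (-c)) := by
    simpa only [birkhoffAverage_neg, Pi.neg_apply] using hc.neg
  have hle := hω.le_integral_of_tendsto_birkhoffAverage hP hf.neg hT hTP hneg
  simp only [Pi.neg_apply, integral_neg] at hle
  exact neg_le_neg_iff.1 hle

theorem mainTheorem1_general [IsProbabilityMeasure P] (hf : ComputableFun f)
    (hT : ComputableTransformation T) (hTP : MeasurePreserving T P P) :
    ∃ f' : Cantor → ℝ, Integrable f' P ∧ (∀ ω, f' (T ω) = f' ω) ∧
      ∫ ω, f' ω ∂P = ∫ ω, f ω ∂P ∧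
      (∀ ω, IsMartinLofRandom P ω → Tendsto (birkhoffAverage ℝ T f · ω) atTop (𝓝 (f' ω))) ∧
      (Ergodic T P → LowerSemicomputable (fun x => P.real (cylinder x)) →
        ∀ ω, IsMartinLofRandom P ω → f' ω = ∫ α, f α ∂P) := by
  obtain ⟨C, hfC⟩ := hf.exists_abs_le
  have hfint := hf.integrable P
  have hrandom : ∀ ω, IsMartinLofRandom P ω →
      Tendsto (birkhoffAverage ℝ T f · ω) atTop (𝓝 (birkhoffLimit T f ω)) := fun ω hω =>
    tendsto_birkhoffLimit (hω.exists_tendsto_birkhoffAverage hf hT hTP)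
  exact ⟨birkhoffLimit T f, integrable_birkhoffLimit hTP hfint hfC, birkhoffLimit_apply hfC,
    integral_birkhoffLimit hTP hfint hfC, hrandom, fun hE hP ω hω =>
      hω.eq_integral_of_tendsto_birkhoffAverage hP hf hT hE (hrandom ω hω)⟩

end ErgodicTheorem

end AlgorithmicErgodic

theorem mainTheorem1
    (P : MeasureTheory.Measure AlgorithmicErgodic.Cantor) [MeasureTheory.IsProbabilityMeasure P]
    (hP : AlgorithmicErgodic.ComputableMeasure P)
    (f : AlgorithmicErgodic.Cantor → ℝ) (hf_nonneg : ∀ ω, 0 ≤ f ω)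
    (hf : AlgorithmicErgodic.ComputableFun f) (hf_int : MeasureTheory.Integrable f P)
    (T : AlgorithmicErgodic.Cantor → AlgorithmicErgodic.Cantor)
    (hT : AlgorithmicErgodic.ComputableTransformation T)
    (hTP : MeasureTheory.MeasurePreserving T P P) :
    ∃ f' : AlgorithmicErgodic.Cantor → ℝ,
      MeasureTheory.Integrable f' P ∧
      (∀ ω, f' (T ω) = f' ω) ∧
      ∫ ω, f' ω ∂P = ∫ ω, f ω ∂P ∧
      (∀ ω, AlgorithmicErgodic.IsMartinLofRandom P ω →
        Filter.Tendsto (fun n : ℕ => birkhoffAverage ℝ T f n ω) Filter.atTop (nhds (f' ω))) ∧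
      (Ergodic T P →
        ∀ ω, AlgorithmicErgodic.IsMartinLofRandom P ω → f' ω = ∫ α, f α ∂P) := by
  obtain ⟨f', hint, hinv, heq, hrandom, hergodic⟩ :=
    AlgorithmicErgodic.mainTheorem1_general hf hT hTP
  exact ⟨f', hint, hinv, heq, hrandom, fun hE => hergodic hE hP.1⟩
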